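/- For a squarefree integer $d\ge 2$ let $K=\mathbb{Q}(\sqrt{-d})$, let $S$ be the set of prime ideals of $\mathcal{O}_K$ lying above $2$, and let $\mathcal{O}_S^{*}\subset K^{*}$ be the group of $S$-units of $K$, i.e. of those $x\in K^*$ with $v_{\mathfrak p}(x)=0$ for every prime $\mathfrak p\notin S$. A solution of the $S$-unit equation $\lambda+\mu=1$, $\lambda,\mu\in\mathcal{O}_S^{*}$, is called relevant if $(\lambda,\mu)\notin\{(-1,2),(2,-1),(\tfrac12,\tfrac12)\}$. Let $\mathbb{N}^{sf}=\{d\ge 2 : d \text{ squarefree}\}$, and say that $\mathcal{U}\subseteq\mathbb{N}^{sf}$ has relative density $\delta_{rel}(\mathcal U)=\delta$ if $$\lim_{X\to\infty}\frac{\#\{d\in\mathcal{U}: d\le X\}}{\#\{d\in\mathbb{N}^{sf}: d\le X\}}$$ exists and equals $\delta$. Let $\mathcal{C}$ be the set of $d\in\mathbb{N}^{sf}$ such that the $S$-unit equation has no relevant solutions in $\mathbb{Q}(\sqrt{-d})$, and let $\mathcal{D}=\{d\in\mathcal{C} : -d\not\equiv 5 \pmod 8\}$. Then both relative densities exist, $\delta_{rel}(\mathcal{C})=1$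 and $\delta_{rel}(\mathcal{D})=5/6$. -/

import Mathlib

open Filter Topology NumberField IsDedekindDomain
open scoped IntermediateField

section SUnitEquation

variable (K : Type*) [Field K] [NumberField K]

/-- The set of primes of the number field `K` lying above `2`. -/
def primesAboveTwo : Set (HeightOneSpectrum (𝓞 K)) :=
  {v | (2 : 𝓞 K) ∈ v.asIdeal}

/-- `(l, m)` solves the `S`-unit equation `l + m = 1`, where `S` is the set of primes above `2`. -/
def IsSUnitSolution (l m : Kˣ) : Prop :=
  l ∈ (primesAboveTwo K).unit K ∧ m ∈ (primesAboveTwo K).unit K ∧ (l : K) + (m : K) = 1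

/-- The irrelevant solutions of the `S`-unit equation. -/
def irrelevantSolutions : Set (K × K) :=
  {(-1, 2), (2, -1), (1 / 2, 1 / 2)}

/-- The `S`-unit equation has a relevant solution in `K`. -/
def HasRelevantSolution : Prop :=
  ∃ l m : Kˣ, IsSUnitSolution K l m ∧ ((l : K), (m : K)) ∉ irrelevantSolutions K

end SUnitEquation

/-- The field `ℚ(√-d)`, as a subfield of `ℂ`. -/
noncomputable abbrev imagQuadField (d : ℕ) : IntermediateField ℚ ℂ :=
  ℚ⟮(Complex.I * (Real.sqrt d : ℂ))⟯

instance imagQuadField_numberField (d : ℕ) : NumberField (imagQuadField d) where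
  to_charZero := inferInstance
  to_finiteDimensional := by
    apply IntermediateField.adjoin.finiteDimensional
    refine ⟨Polynomial.X ^ 2 + Polynomial.C (d : ℚ),
      Polynomial.monic_X_pow_add_C _ (by norm_num), ?_⟩
    have h : ((Real.sqrt d : ℝ) : ℂ) ^ 2 = (d : ℂ) := by
      rw [← Complex.ofReal_pow, Real.sq_sqrt (Nat.cast_nonneg d), Complex.ofReal_natCast]
    simp [mul_pow, h]

/-- The squarefree integers `d ≥ 2`. -/
def squarefreeNat : Set ℕ := {d | 2 ≤ d ∧ Squarefree d}

/-- The set `U` of squarefree integers `≥ 2` has relative density `δ` among all of them. -/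
def HasRelativeDensity (U : Set ℕ) (δ : ℝ) : Prop :=
  Tendsto (fun X : ℝ => (({d ∈ U | (d : ℝ) ≤ X}.ncard : ℕ) : ℝ) /
    (({d ∈ squarefreeNat | (d : ℝ) ≤ X}.ncard : ℕ) : ℝ)) atTop (𝓝 δ)

/-- The squarefree `d ≥ 2` such that the `S`-unit equation has no relevant solution
in `ℚ(√-d)`. -/
def noRelevantSet : Set ℕ :=
  {d ∈ squarefreeNat | ¬ HasRelevantSolution (imagQuadField d)}

/-- The elements `d` of `noRelevantSet` with `-d ≢ 5 (mod 8)`. -/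
def noRelevantSetNotFive : Set ℕ :=
  {d ∈ noRelevantSet | ¬ (-(d : ℤ) ≡ 5 [ZMOD 8])}

/-! Both densities follow once the `d` admitting a relevant solution are shown to have density zero.
If `λ + μ = 1` in `ℚ(√-d)`, the norms of `λ` and `μ` are powers of 2, so the triangle `0, 1, λ` in
`ℂ` has squared sides `1, 2^r, 2^s`. Heron's formula gives `d z² = triangleForm 1 (2^r) (2^s)` with
`z ≠ 0`, unless `λ` is rational, which leaves the irrelevant solutions. After scaling the shortest
side to 1, the triangle inequality makes the two longer squared sides equal or in ratio 2, and `d`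
is then the squarefree part of some `2^m - 1` (`exists_two_pow_eq_of_hasRelevantSolution`).

Each `m` yields only one `d`, so it suffices to bound `m` by `o(d)`. The equation `d y² + 1 = 2^m`
gives a solution of Pell's equation for `d` or `2d`, and divisibility by 2 forces it to be the
fundamental one (`two_pow_le_of_mul_sq_add_one_eq`). A pigeonhole argument on ideals of small norm
bounds that solution (`exists_pell_solution_le`), so `m = O(d^(5/6) log d)`.

A Möbius sieve gives each odd class mod 8 the same squarefree density `C/8`, with `C > 0`. Since
even squarefree numbers are doubles of odd ones, the total is `C/2 + C/4`. Hence `d ≡ 3 (mod 8)` has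
relative density `1/6`. -/

/-! ### Triangles whose squared sides are powers of 2 -/

/-- Sixteen times the squared area of a triangle whose squared side lengths are `a`, `b`, `c`. -/
def triangleForm (a b c : ℚ) : ℚ :=
  2 * a * b + 2 * b * c + 2 * c * a - a ^ 2 - b ^ 2 - c ^ 2

theorem exists_nat_sq_of_squarefree_mul_sq_eq {d n : ℕ} (hd : Squarefree d) {z : ℚ}
    (h : (d : ℚ) * z ^ 2 = n) : ∃ y : ℕ, d * y ^ 2 = n := by
  have hz : (z.den : ℚ) ≠ 0 := by exact_mod_cast z.den_ne_zero
  have h1 : d * z.num.natAbs ^ 2 = n * z.den ^ 2 := by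
    have h2 : (d : ℚ) * z.num ^ 2 = n * z.den ^ 2 := by
      rw [← h]
      nth_rewrite 2 [← Rat.num_div_den z]
      field_simp
    have h3 : (d : ℤ) * z.num ^ 2 = n * z.den ^ 2 := by exact_mod_cast h2
    zify
    rw [sq_abs]
    exact h3
  have hdvd : z.den ^ 2 ∣ d := by
    have hc : Nat.Coprime (z.den ^ 2) (z.num.natAbs ^ 2) := (z.reduced.symm).pow 2 2
    exact hc.dvd_of_dvd_mul_right (h1 ▸ Dvd.intro_left n rfl)
  have hden : z.den = 1 := by
    rw [pow_two] at hdvd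
    exact Nat.isUnit_iff.mp (hd _ hdvd)
  refine ⟨z.num.natAbs, ?_⟩
  simpa [hden] using h1

/-- If the longest squared side is at least `4 * 2^p`, the longest side is at least twice the middle
one, hence at least the sum of the other two, and the form is nonpositive. Ratio 1 gives `2^(p+2) -
1`; ratio 2 leaves only the values 4, 7, 7 for `p = 0, 1, 2`. -/
theorem exists_two_pow_eq_of_triangleForm_one {d : ℕ} (hd : Squarefree d) (hd2 : 2 ≤ d)
    {p q : ℕ} (hpq : p ≤ q) {z : ℚ} (hz : z ≠ 0)
    (h : (d : ℚ) * z ^ 2 = triangleForm 1 (2 ^ p) (2 ^ q)) :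
    ∃ m y : ℕ, m ≠ 0 ∧ d * y ^ 2 + 1 = 2 ^ m := by
  have hpos : 0 < triangleForm 1 (2 ^ p) (2 ^ q) := by
    rw [← h]
    have : (0 : ℚ) < d := by exact_mod_cast (by omega : 0 < d)
    positivity
  have finish (m : ℕ) (hm0 : m ≠ 0) (hm : triangleForm 1 (2 ^ p) (2 ^ q) = 2 ^ m - 1) :
      ∃ m y : ℕ, m ≠ 0 ∧ d * y ^ 2 + 1 = 2 ^ m := by
    obtain ⟨y, hy⟩ := exists_nat_sq_of_squarefree_mul_sq_eq (n := 2 ^ m - 1) hd (z := z) (by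
      rw [h, hm, Nat.cast_sub Nat.one_le_two_pow]; push_cast; ring)
    exact ⟨m, y, hm0, by rw [hy]; exact Nat.sub_add_cancel Nat.one_le_two_pow⟩
  have hP : (1 : ℚ) ≤ 2 ^ p := one_le_pow₀ (by norm_num)
  obtain ⟨k, rfl⟩ := Nat.exists_eq_add_of_le hpq
  rcases Nat.lt_or_ge k 2 with hk | hk
  · interval_cases k
    · refine finish (p + 2) (by omega) ?_
      simp only [triangleForm, add_zero, pow_add]
      ring
    · have hF : triangleForm 1 (2 ^ p) (2 ^ (p + 1)) = 6 * 2 ^ p - 1 - (2 ^ p) ^ 2 := by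
        simp only [triangleForm, pow_add]
        ring
      rcases Nat.lt_or_ge p 3 with hp | hp
      · interval_cases p
        -- The value 4 would need `d` to be 1 or 4.
        · exfalso
          obtain ⟨y, hy⟩ := exists_nat_sq_of_squarefree_mul_sq_eq (n := 4) hd (z := z) (by
            rw [h, hF]; norm_num)
          have hy2 : y ≤ 2 := by nlinarith
          interval_cases y
          · omega
          · have : d = 4 := by omega
            subst this
            have := hd 2 (by norm_num)
            simp at this
          · omega
        · exact finish 3 (by norm_num) (by rw [hF]; norm_num)
        · exact finish 3 (by norm_num) (by rw [hF]; norm_num)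
      · have h8 : (8 : ℚ) ≤ 2 ^ p := by
          calc (8 : ℚ) = 2 ^ 3 := by norm_num
            _ ≤ 2 ^ p := pow_le_pow_right₀ (by norm_num) hp
        rw [hF] at hpos
        nlinarith
  · exfalso
    have h4 : (4 : ℚ) ≤ 2 ^ k := by
      calc (4 : ℚ) = 2 ^ 2 := by norm_num
        _ ≤ 2 ^ k := pow_le_pow_right₀ (by norm_num) hk
    have hF : triangleForm 1 (2 ^ p) (2 ^ (p + k)) = 4 * 2 ^ p - (2 ^ p * 2 ^ k - 2 ^ p - 1) ^ 2 := by
      simp only [triangleForm, pow_add]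
      ring
    rw [hF] at hpos
    have h3 : 3 * 2 ^ p - 1 ≤ (2 : ℚ) ^ p * 2 ^ k - 2 ^ p - 1 := by nlinarith
    have h5 : (3 * 2 ^ p - 1) ^ 2 ≤ ((2 : ℚ) ^ p * 2 ^ k - 2 ^ p - 1) ^ 2 :=
      pow_le_pow_left₀ (by linarith) h3 2
    nlinarith

theorem triangleForm_mul (t a b c : ℚ) :
    triangleForm (t * a) (t * b) (t * c) = t ^ 2 * triangleForm a b c := by
  simp only [triangleForm]
  ring

theorem exists_two_pow_eq_of_triangleForm_of_le {d : ℕ} (hd : Squarefree d) (hd2 : 2 ≤ d)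
    {e f g : ℤ} (hef : e ≤ f) (hfg : f ≤ g) {z : ℚ} (hz : z ≠ 0)
    (h : (d : ℚ) * z ^ 2 = triangleForm (2 ^ e) (2 ^ f) (2 ^ g)) :
    ∃ m y : ℕ, m ≠ 0 ∧ d * y ^ 2 + 1 = 2 ^ m := by
  obtain ⟨p, rfl⟩ := Int.le.dest hef
  obtain ⟨k, rfl⟩ := Int.le.dest hfg
  have h2 : (2 : ℚ) ≠ 0 := two_ne_zero
  have he : (2 : ℚ) ^ e ≠ 0 := zpow_ne_zero _ h2
  refine exists_two_pow_eq_of_triangleForm_one hd hd2 (Nat.le_add_right p k)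
    (z := z / 2 ^ e) (div_ne_zero hz he) ?_
  have key : triangleForm (2 ^ e) (2 ^ (e + p)) (2 ^ (e + p + k)) =
      (2 ^ e) ^ 2 * triangleForm 1 (2 ^ p) (2 ^ (p + k)) := by
    rw [← triangleForm_mul, zpow_add₀ h2, zpow_add₀ h2, zpow_add₀ h2, pow_add]
    simp [mul_assoc]
  rw [key] at h
  rw [div_pow, mul_div_assoc', h]
  field_simp

theorem exists_two_pow_eq_of_triangleForm {d : ℕ} (hd : Squarefree d) (hd2 : 2 ≤ d)
    (e f g : ℤ) {z : ℚ} (hz : z ≠ 0)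
    (h : (d : ℚ) * z ^ 2 = triangleForm (2 ^ e) (2 ^ f) (2 ^ g)) :
    ∃ m y : ℕ, m ≠ 0 ∧ d * y ^ 2 + 1 = 2 ^ m := by
  have comm₁ (a b c : ℚ) : triangleForm a b c = triangleForm b a c := by
    simp only [triangleForm]; ring
  have comm₂ (a b c : ℚ) : triangleForm a b c = triangleForm a c b := by
    simp only [triangleForm]; ring
  have main {e f g : ℤ} := exists_two_pow_eq_of_triangleForm_of_le (e := e) (f := f) (g := g) hd hd2
  rcases le_total e f with h1 | h1 <;> rcases le_total f g with h2 | h2 <;>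
    rcases le_total e g with h3 | h3
  · exact main h1 h2 hz h
  · exact main h1 h2 hz h
  · exact main h3 h2 hz (h.trans (comm₂ _ _ _))
  · exact main h3 h1 hz (h.trans ((comm₂ _ _ _).trans (comm₁ _ _ _)))
  · exact main h1 h3 hz (h.trans (comm₁ _ _ _))
  · exact main h2 h3 hz (h.trans ((comm₁ _ _ _).trans (comm₂ _ _ _)))
  · exact main h2 h1 hz (h.trans ((comm₁ _ _ _).trans ((comm₂ _ _ _).trans (comm₁ _ _ _))))
  · exact main h2 h1 hz (h.trans ((comm₁ _ _ _).trans ((comm₂ _ _ _).trans (comm₁ _ _ _))))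

/-! ### Rational solutions -/

theorem eq_one_or_neg_one_of_odd_of_sq_eq_two_zpow {c s : ℤ} (hc : Odd c)
    (h : (c : ℚ) ^ 2 = 2 ^ s) : c = 1 ∨ c = -1 := by
  rcases le_or_gt 0 s with hs | hs
  · lift s to ℕ using hs
    have h' : c ^ 2 = 2 ^ s := by
      rw [zpow_natCast] at h
      exact_mod_cast h
    have hs : s = 0 := by
      by_contra hs
      have h1 : Even (c ^ 2) := h' ▸ (even_two.pow_of_ne_zero hs)
      exact (Int.not_even_iff_odd.mpr (hc.pow)) h1
    rw [hs, pow_zero] at h'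
    simpa using h'
  · exfalso
    have h1 : (2 : ℚ) ^ s < 1 := zpow_lt_one_of_neg₀ (by norm_num) hs
    have h0 : c ≠ 0 := by rintro rfl; simp at hc
    have h2 : (1 : ℚ) ≤ (c : ℚ) ^ 2 := by
      have : 0 < c ^ 2 := by positivity
      exact_mod_cast this
    linarith

theorem exists_int_of_sq_eq_two_pow {a : ℚ} {k : ℕ} (h : a ^ 2 = 2 ^ k) :
    ∃ c : ℤ, a = c ∧ c ^ 2 = 2 ^ k := by
  obtain ⟨y, hy⟩ := exists_nat_sq_of_squarefree_mul_sq_eq (n := 2 ^ k) squarefree_one (z := a)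
    (by simpa using h)
  have hy' : (y : ℚ) ^ 2 = 2 ^ k := by
    have : y ^ 2 = 2 ^ k := by simpa using hy
    exact_mod_cast this
  rcases sq_eq_sq_iff_eq_or_eq_neg.mp (h.trans hy'.symm) with h1 | h1
  · exact ⟨y, by simpa using h1, by exact_mod_cast hy'⟩
  · refine ⟨-y, by simpa using h1, ?_⟩
    rw [neg_sq]
    exact_mod_cast hy'

/-- The only rational `S`-units `a` with `1 - a` an `S`-unit, for `S = {2}`. -/
theorem eq_of_sq_eq_two_zpow {a : ℚ} {r s : ℤ} (hr : a ^ 2 = 2 ^ r) (hs : (1 - a) ^ 2 = 2 ^ s) :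
    a = -1 ∨ a = 2 ∨ a = 1 / 2 := by
  have two_of_even {c : ℤ} {k : ℕ} (hk : k ≠ 0) (hc : c ^ 2 = 2 ^ k) {t : ℤ}
      (ht : ((c : ℚ) - 1) ^ 2 = 2 ^ t) : c = 2 := by
    have he : Even c := by
      have : Even (c ^ 2) := hc ▸ even_two.pow_of_ne_zero hk
      exact (Int.even_pow.mp this).1
    have h0 : c ≠ 0 := by
      rintro rfl
      have : (0 : ℤ) < 2 ^ k := by positivity
      simp at hc
      omega
    have := eq_one_or_neg_one_of_odd_of_sq_eq_two_zpow (he.sub_odd odd_one) (s := t)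
      (by push_cast; exact ht)
    omega
  rcases le_or_gt 0 r with h0 | h0
  · lift r to ℕ using h0
    rw [zpow_natCast] at hr
    obtain ⟨c, rfl, hc⟩ := exists_int_of_sq_eq_two_pow hr
    rcases Nat.eq_zero_or_pos r with rfl | hr0
    · rw [pow_zero] at hc
      rcases (by simpa using hc : c = 1 ∨ c = -1) with rfl | rfl
      · have : (2 : ℚ) ^ s ≠ 0 := zpow_ne_zero _ two_ne_zero
        simp [this.symm] at hs
      · left; norm_num
    · right; left
      have := two_of_even hr0.ne' hc (t := s) (by rw [← hs]; ring)
      rw [this]; norm_num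
  -- For `r < 0` pass to `a⁻¹`, an integer, using `(a⁻¹ - 1)² = (1 - a)² / a² = 2^(s - r)`.
  · obtain ⟨k, hk⟩ := Int.eq_ofNat_of_zero_le (by omega : 0 ≤ -r)
    obtain ⟨c, hca, hc⟩ := exists_int_of_sq_eq_two_pow (a := a⁻¹) (k := k) (by
      rw [inv_pow, hr, ← zpow_neg, hk, zpow_natCast])
    have ha : a ≠ 0 := by
      rintro rfl
      have : (2 : ℚ) ^ r ≠ 0 := zpow_ne_zero _ two_ne_zero
      simp [this.symm] at hr
    have := two_of_even (by omega) hc (t := s - r) (by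
      rw [← hca, zpow_sub₀ two_ne_zero, ← hr, ← hs]; field_simp)
    right; right
    rw [this] at hca
    rw [← inv_inv a, hca]; norm_num

/-! ### Norms of `S`-units in `ℚ(√-d)` -/

theorem exists_isIntegral_two_pow_mul {K : Type*} [Field K] [NumberField K] {x : K}
    (hx : ∀ v ∉ primesAboveTwo K, v.valuation K x ≤ 1) :
    ∃ n : ℕ, IsIntegral ℤ (2 ^ n * x) := by
  have hval2 (v : HeightOneSpectrum (𝓞 K)) : v.valuation K (2 : K) ≤ 1 := by
    simpa only [Algebra.cast, map_ofNat] using v.valuation_le_one (K := K) (2 : 𝓞 K)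
  have hfin := HeightOneSpectrum.Support.finite (𝓞 K) x
  have hex (v : HeightOneSpectrum (𝓞 K)) : ∃ n : ℕ, v.valuation K (2 ^ n * x) ≤ 1 := by
    by_cases hv : v ∈ primesAboveTwo K
    · have h2 : v.valuation K (2 : K) < 1 := by
        simpa only [Algebra.cast, map_ofNat] using (v.valuation_lt_one_iff_mem (K := K) (2 : 𝓞 K)).mpr hv
      have h20 : v.valuation K (2 : K) ≠ 0 := (Valuation.ne_zero_iff _).mpr two_ne_zero
      obtain ⟨n, hn⟩ := MulArchimedean.arch (v.valuation K x)
        ((one_lt_inv₀ (zero_lt_iff.mpr h20)).mpr h2)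
      refine ⟨n, ?_⟩
      rw [map_mul, map_pow]
      calc _ ≤ v.valuation K (2 : K) ^ n * (v.valuation K (2 : K))⁻¹ ^ n := by gcongr
        _ = 1 := by rw [← mul_pow, mul_inv_cancel₀ h20, one_pow]
    · exact ⟨0, by simpa using hx v hv⟩
  choose n hn using hex
  refine ⟨hfin.toFinset.sup n, ?_⟩
  obtain ⟨y, hy⟩ := HeightOneSpectrum.mem_integers_of_valuation_le_one (R := 𝓞 K) K
    (2 ^ hfin.toFinset.sup n * x) fun v => by
      by_cases hv : v ∈ HeightOneSpectrum.Support (𝓞 K) x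
      · obtain ⟨k, hk⟩ := Nat.exists_eq_add_of_le
          (Finset.le_sup (f := n) (hfin.mem_toFinset.mpr hv))
        rw [hk, add_comm, pow_add, mul_assoc, map_mul, map_pow]
        exact mul_le_one' (pow_le_one' (hval2 v) k) (hn v)
      · rw [map_mul, map_pow]
        exact mul_le_one' (pow_le_one' (hval2 v) _) (not_lt.mp hv)
  rw [← hy]
  exact y.isIntegral_coe

theorem normSq_coords (d : ℕ) (a b : ℚ) :
    Complex.normSq (a + b * (Complex.I * (Real.sqrt d : ℂ))) = ((a ^ 2 + d * b ^ 2 : ℚ) : ℝ) := by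
  have h : (Real.sqrt d) ^ 2 = d := Real.sq_sqrt (Nat.cast_nonneg d)
  simp [Complex.normSq_apply]
  linear_combination (b : ℝ) ^ 2 * h

theorem exists_coords_of_mem_imagQuadField {d : ℕ} {x : ℂ} (hx : x ∈ imagQuadField d) :
    ∃ a b : ℚ, x = a + b * (Complex.I * (Real.sqrt d : ℂ)) := by
  have hsq : (Complex.I * (Real.sqrt d : ℂ)) ^ 2 = -d := by
    rw [mul_pow, ← Complex.ofReal_pow, Real.sq_sqrt (Nat.cast_nonneg d)]
    simp
  induction hx using IntermediateField.adjoin_induction with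
  | mem x hx => exact ⟨0, 1, by simp [Set.mem_singleton_iff.mp hx]⟩
  | algebraMap q => exact ⟨q, 0, by simp⟩
  | add x y _ _ hx hy =>
    obtain ⟨a, b, rfl⟩ := hx
    obtain ⟨a', b', rfl⟩ := hy
    exact ⟨a + a', b + b', by push_cast; ring⟩
  | mul x y _ _ hx hy =>
    obtain ⟨a, b, rfl⟩ := hx
    obtain ⟨a', b', rfl⟩ := hy
    refine ⟨a * a' - d * (b * b'), a * b' + b * a', ?_⟩
    push_cast
    linear_combination (b * b' : ℂ) * hsq
  | inv x _ hx =>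
    obtain ⟨a, b, rfl⟩ := hx
    set w := Complex.I * (Real.sqrt d : ℂ)
    by_cases h0 : (a + b * w : ℂ) = 0
    · exact ⟨0, 0, by simp [h0]⟩
    · have hN : (a + b * w : ℂ) * (a - b * w) = ((a ^ 2 + d * b ^ 2 : ℚ) : ℂ) := by
        push_cast
        linear_combination -(b : ℂ) ^ 2 * hsq
      have hN0 : ((a ^ 2 + d * b ^ 2 : ℚ) : ℂ) ≠ 0 := by
        have h1 := Complex.normSq_pos.mpr h0
        rw [normSq_coords] at h1
        exact_mod_cast h1.ne'
      refine ⟨a / (a ^ 2 + d * b ^ 2), -b / (a ^ 2 + d * b ^ 2), inv_eq_of_mul_eq_one_right ?_⟩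
      calc (a + b * w) * (((a / (a ^ 2 + d * b ^ 2) : ℚ) : ℂ) +
            ((-b / (a ^ 2 + d * b ^ 2) : ℚ) : ℂ) * w)
          = ((a + b * w) * (a - b * w)) / ((a ^ 2 + d * b ^ 2 : ℚ) : ℂ) := by push_cast; ring
        _ = 1 := by rw [hN, div_self hN0]

theorem exists_int_normSq_eq {x : ℂ} (hx : IsIntegral ℤ x) {q : ℚ} (hq : Complex.normSq x = q) :
    ∃ c : ℤ, q = c := by
  have h1 : IsIntegral ℤ (x * (starRingEnd ℂ) x) :=
    hx.mul (hx.map (starRingEnd ℂ).toIntAlgHom)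
  rw [Complex.mul_conj, hq] at h1
  have h2 : IsIntegral ℤ (algebraMap ℚ ℂ q) := by simpa using h1
  rw [isIntegral_algebraMap_iff (algebraMap ℚ ℂ).injective] at h2
  obtain ⟨c, hc⟩ := IsIntegrallyClosed.isIntegral_iff.mp h2
  exact ⟨c, by simpa using hc.symm⟩

/-- Powers of 2 clear the denominators of both `l` and `l⁻¹`. Their norms, multiplied by powers of
4, become integers whose product is a power of 4, so each is a power of 2 up to sign. -/
theorem exists_normSq_eq_two_zpow {d : ℕ} {l : (imagQuadField d)ˣ}
    (hl : l ∈ (primesAboveTwo (imagQuadField d)).unit (imagQuadField d)) {q : ℚ}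
    (hq : Complex.normSq ((l : imagQuadField d) : ℂ) = q) : ∃ r : ℤ, q = 2 ^ r := by
  have integral_norm {u : (imagQuadField d)ˣ} {t : ℚ}
      (hu : u ∈ (primesAboveTwo (imagQuadField d)).unit (imagQuadField d))
      (ht : Complex.normSq ((u : imagQuadField d) : ℂ) = t) :
      ∃ (n : ℕ) (c : ℤ), 4 ^ n * t = c := by
    obtain ⟨n, hn⟩ := exists_isIntegral_two_pow_mul fun v hv => (hu v hv).le
    obtain ⟨c, hc⟩ := exists_int_normSq_eq (q := 4 ^ n * t)
      (hn.map ((imagQuadField d).val.restrictScalars ℤ)) (by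
        have h2 : Complex.normSq (((2 : imagQuadField d)) : ℂ) = 4 := by
          change Complex.normSq (2 : ℂ) = 4
          norm_num [Complex.normSq_apply]
        simp [ht, h2])
    exact ⟨n, c, hc⟩
  obtain ⟨n₁, c₁, h₁⟩ := integral_norm hl hq
  obtain ⟨n₂, c₂, h₂⟩ := integral_norm (t := q⁻¹) (inv_mem hl) (by simp [hq])
  have hq0 : 0 < q := by
    have : 0 < Complex.normSq ((l : imagQuadField d) : ℂ) := Complex.normSq_pos.mpr (by simp)
    rw [hq] at this
    exact_mod_cast this
  have hc₁ : 0 < c₁ := by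
    have : (0 : ℚ) < c₁ := by rw [← h₁]; positivity
    exact_mod_cast this
  lift c₁ to ℕ using hc₁.le
  have hmul : (c₁ : ℤ) * c₂ = 2 ^ (2 * (n₁ + n₂)) := by
    have : ((c₁ : ℤ) : ℚ) * c₂ = 4 ^ (n₁ + n₂) := by
      rw [← h₁, ← h₂]
      field_simp
      rw [pow_add]
    rw [pow_mul]
    norm_num
    exact_mod_cast this
  have hdvd : c₁ ∣ 2 ^ (2 * (n₁ + n₂)) := by
    have : (c₁ : ℤ) ∣ ((2 ^ (2 * (n₁ + n₂)) : ℕ) : ℤ) := ⟨c₂, by rw [hmul]; push_cast; rfl⟩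
    exact_mod_cast this
  obtain ⟨j, -, rfl⟩ := (Nat.dvd_prime_pow Nat.prime_two).mp hdvd
  refine ⟨j - 2 * n₁, ?_⟩
  rw [zpow_sub₀ two_ne_zero, eq_div_iff (zpow_ne_zero _ two_ne_zero), zpow_natCast, zpow_mul,
    zpow_natCast]
  push_cast at h₁
  rw [← h₁]
  norm_num
  ring

/-- A relevant solution in `ℚ(√-d)` makes `d` the squarefree part of a number `2 ^ m - 1`. -/
theorem exists_two_pow_eq_of_hasRelevantSolution {d : ℕ} (hd : Squarefree d) (hd2 : 2 ≤ d)
    (h : HasRelevantSolution (imagQuadField d)) : ∃ m y : ℕ, m ≠ 0 ∧ d * y ^ 2 + 1 = 2 ^ m := by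
  obtain ⟨l, m, ⟨hl, hm, hlm⟩, hrel⟩ := h
  obtain ⟨a, b, hab⟩ := exists_coords_of_mem_imagQuadField (l : imagQuadField d).2
  have hm' : ((m : imagQuadField d) : ℂ) =
      ((1 - a : ℚ) : ℂ) + ((-b : ℚ) : ℂ) * (Complex.I * (Real.sqrt d : ℂ)) := by
    rw [eq_sub_of_add_eq' hlm]
    push_cast
    rw [hab]
    ring
  obtain ⟨r, hr⟩ := exists_normSq_eq_two_zpow hl (by rw [hab, normSq_coords])
  obtain ⟨s, hs⟩ := exists_normSq_eq_two_zpow hm (by rw [hm', normSq_coords])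
  have hb : b ≠ 0 := by
    rintro rfl
    refine hrel ?_
    have hla : (l : imagQuadField d) = (a : imagQuadField d) := by
      apply Subtype.ext
      rw [hab]
      simp
    have hma : (m : imagQuadField d) = 1 - (a : imagQuadField d) := by
      rw [← hla]
      exact eq_sub_of_add_eq' hlm
    rw [hla, hma]
    rcases eq_of_sq_eq_two_zpow (a := a) (r := r) (s := s) (by simpa using hr) (by simpa using hs)
      with rfl | rfl | rfl
    · left
      norm_num
    · right; left
      norm_num
    · right; right
      norm_num
  -- The triangle `0, 1, l` has base 1 and height `|b|√d`, so 16 times its squared area is `d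
  -- (2b)²`.
  refine exists_two_pow_eq_of_triangleForm hd hd2 0 r s (z := 2 * b) (by positivity) ?_
  rw [← hr, ← hs, triangleForm]
  ring

/-! ### A divisor bound -/

/-- By multiplicativity: a prime `p ≥ 8` satisfies `(e + 1)³ ≤ 8^e ≤ p^e`, and each smaller prime
costs at most a factor 8. The outer exponent 8 is a crude count of the primes below 8. Any divisor
bound `O(n^ε)` with `ε < 1/2` would serve later. -/
theorem card_divisors_pow_three_le {n : ℕ} (hn : n ≠ 0) : n.divisors.card ^ 3 ≤ 8 ^ 8 * n := by
  have two (e : ℕ) : (e + 1) ^ 3 ≤ 8 * 2 ^ e := by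
    induction e using Nat.twoStepInduction with
    | zero => norm_num
    | one => norm_num
    | more e _ ih =>
      rcases Nat.lt_or_ge e 2 with he | he
      · interval_cases e <;> norm_num
      · have : (e + 2 + 1) ^ 3 ≤ 2 * (e + 1 + 1) ^ 3 := by
          obtain ⟨k, rfl⟩ := Nat.exists_eq_add_of_le he
          ring_nf
          nlinarith [Nat.zero_le k, Nat.zero_le (k ^ 2), Nat.zero_le (k ^ 3)]
        calc _ ≤ _ := this
          _ ≤ 2 * (8 * 2 ^ (e + 1)) := by gcongr
          _ = _ := by ring
  have factor (p e : ℕ) (hp : p.Prime) : (e + 1) ^ 3 ≤ (if p < 8 then 8 else 1) * p ^ e := by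
    split_ifs with h
    · calc _ ≤ _ := two e
        _ ≤ _ := by gcongr; exact hp.two_le
    · rw [one_mul]
      calc (e + 1) ^ 3 ≤ (2 ^ e) ^ 3 := by gcongr; exact Nat.lt_two_pow_self
        _ = 8 ^ e := by rw [← pow_mul, mul_comm, pow_mul]; norm_num
        _ ≤ p ^ e := by gcongr; omega
  have const : ∏ p ∈ n.primeFactors, (if p < 8 then 8 else 1) ≤ 8 ^ 8 := by
    rw [Finset.prod_ite, Finset.prod_const_one, mul_one, Finset.prod_const]
    refine Nat.pow_le_pow_right (by norm_num) ?_
    calc _ ≤ (Finset.range 8).card := Finset.card_le_card fun p hp => by simp_all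
      _ = 8 := by simp
  rw [Nat.card_divisors hn, ← Finset.prod_pow]
  calc _ ≤ ∏ p ∈ n.primeFactors, ((if p < 8 then 8 else 1) * p ^ n.factorization p) :=
        Finset.prod_le_prod' fun p hp => factor p _ (Nat.prime_of_mem_primeFactors hp)
    _ = (∏ p ∈ n.primeFactors, (if p < 8 then 8 else 1)) * n := by
        rw [Finset.prod_mul_distrib]
        congr 1
        exact Nat.prod_factorization_pow_eq_self hn
    _ ≤ 8 ^ 8 * n := by gcongr

/-! ### An upper bound for the fundamental Pell solution -/

/-- An integer exceeding `2 √D`. -/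
def pellScale (D : ℕ) : ℕ := 2 * (D.sqrt + 1)

/-- Data `(r, |n|, sign n)` determining the ideal `(n, r - √D)` of norm `|n|` in `ℤ[√D]`, where
`r ^ 2 ≡ D` modulo `n`. -/
def pellKeys (D : ℕ) : Finset (Σ _ : ℕ, ℕ × Bool) :=
  (Finset.range (pellScale D)).sigma fun r =>
    (((r : ℤ) ^ 2 - D).natAbs.divisors ×ˢ (Finset.univ : Finset Bool))

theorem le_pellScale_sq (D : ℕ) : D ≤ pellScale D ^ 2 := by
  have := Nat.lt_succ_sqrt D
  rw [pellScale]
  nlinarith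

theorem card_pellKeys_pow_three_le {D : ℕ} (hD : ¬ IsSquare D) :
    (pellKeys D).card ^ 3 ≤ 8 ^ 9 * pellScale D ^ 5 := by
  set M := pellScale D with hM
  have hterm (r : ℕ) (hr : r ∈ Finset.range M) :
      ((r : ℤ) ^ 2 - D).natAbs.divisors.card ^ 3 ≤ 8 ^ 8 * M ^ 2 := by
    have h0 : ((r : ℤ) ^ 2 - D).natAbs ≠ 0 := by
      intro h
      have : (r : ℤ) ^ 2 = D := by omega
      exact hD ⟨r, by rw [← pow_two]; exact_mod_cast this.symm⟩
    have hle : ((r : ℤ) ^ 2 - D).natAbs ≤ M ^ 2 := by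
      have h1 := le_pellScale_sq D
      have h2 : r ^ 2 ≤ M ^ 2 := Nat.pow_le_pow_left (Finset.mem_range.mp hr).le 2
      zify at h1 h2 ⊢
      rw [abs_le]
      constructor <;> nlinarith
    exact (card_divisors_pow_three_le h0).trans (by gcongr)
  obtain ⟨r₀, hr₀, hmax⟩ := Finset.exists_max_image (Finset.range M)
    (fun r => ((r : ℤ) ^ 2 - D).natAbs.divisors.card) ⟨0, by simp [hM, pellScale]⟩
  have hcard : (pellKeys D).card ≤ M * (((r₀ : ℤ) ^ 2 - D).natAbs.divisors.card * 2) := by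
    rw [pellKeys, Finset.card_sigma]
    refine (Finset.sum_le_card_nsmul _ _ (((r₀ : ℤ) ^ 2 - D).natAbs.divisors.card * 2)
      fun r hr => ?_).trans_eq (by simp [hM])
    rw [Finset.card_product, Finset.card_univ, Fintype.card_bool]
    exact Nat.mul_le_mul_right 2 (hmax r hr)
  calc _ ≤ (M * (((r₀ : ℤ) ^ 2 - D).natAbs.divisors.card * 2)) ^ 3 := by gcongr
    _ = 8 * M ^ 3 * ((r₀ : ℤ) ^ 2 - D).natAbs.divisors.card ^ 3 := by ring
    _ ≤ 8 * M ^ 3 * (8 ^ 8 * M ^ 2) := by gcongr; exact hterm r₀ hr₀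
    _ = 8 ^ 9 * M ^ 5 := by ring

theorem two_mul_sqrt_lt_pellScale (D : ℕ) : 2 * √(D : ℝ) < pellScale D := by
  have : √(D : ℝ) < D.sqrt + 1 := by
    rw [Real.sqrt_lt' (by positivity)]
    have := Nat.lt_succ_sqrt' D
    exact_mod_cast this
  rw [pellScale]
  push_cast
  linarith

/-- Dirichlet approximation with denominators below `M^i`, where `M = pellScale D`, gives `|x - y√D|
≤ M^(-i)`, hence norm at most `2√D < M` in absolute value. The norm is a nonzero integer, which
forces `x + y√D ≥ M^i`. The windows `[M^i, M^(i+1))` are disjoint for distinct `i`. -/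
theorem exists_coprime_approx {D : ℕ} (hD : ¬ IsSquare D) {i : ℕ} (hi : i ≠ 0) :
    ∃ x y : ℤ, IsCoprime x y ∧ x ^ 2 - D * y ^ 2 ≠ 0 ∧ |x ^ 2 - D * y ^ 2| < pellScale D ∧
      (pellScale D : ℝ) ^ i ≤ x + y * √(D : ℝ) ∧
      x + y * √(D : ℝ) < (pellScale D : ℝ) ^ (i + 1) := by
  set M := pellScale D with hM
  set s := √(D : ℝ) with hs
  have hs2 : s ^ 2 = D := Real.sq_sqrt (Nat.cast_nonneg D)
  have hsM : 2 * s < M := two_mul_sqrt_lt_pellScale D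
  have hD1 : 1 ≤ D := by
    rcases Nat.eq_zero_or_pos D with rfl | h
    · simp at hD
    · exact h
  have hs1 : 1 ≤ s := Real.one_le_sqrt.mpr (by exact_mod_cast hD1)
  have hM2 : 2 ≤ M := by simp [hM, pellScale]
  have hMi : 2 ≤ M ^ i := hM2.trans (Nat.le_self_pow hi M)
  obtain ⟨q, hq, hqn⟩ := Real.exists_rat_abs_sub_le_and_den_le s (n := M ^ i - 1) (by omega)
  have hn : ((M ^ i - 1 : ℕ) : ℝ) + 1 = (M : ℝ) ^ i := by
    rw [Nat.cast_sub (by omega)]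
    push_cast
    ring
  rw [hn] at hq
  have hy : (0 : ℝ) < q.den := by exact_mod_cast q.pos
  have hy1 : (1 : ℝ) ≤ q.den := by exact_mod_cast q.pos
  have hT : (2 : ℝ) ≤ (M : ℝ) ^ i := by exact_mod_cast hMi
  have hqn' : (q.den : ℝ) + 1 ≤ (M : ℝ) ^ i := by
    rw [← hn]
    have : (q.den : ℝ) ≤ ((M ^ i - 1 : ℕ) : ℝ) := by exact_mod_cast hqn
    linarith
  set T := (M : ℝ) ^ i
  have hclose : |(q.num : ℝ) - q.den * s| ≤ 1 / T := by
    have h1 : (q.num : ℝ) - q.den * s = -(q.den * (s - q)) := by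
      have hqe : (q : ℝ) * q.den = q.num := by exact_mod_cast Rat.mul_den_eq_num q
      linear_combination -hqe
    rw [h1, abs_neg, abs_mul, abs_of_pos hy]
    calc q.den * |s - q| ≤ q.den * (1 / (T * q.den)) := by gcongr
      _ = 1 / T := by field_simp
  have hT1 : 1 / T ≤ 1 := by
    rw [div_le_one (by linarith)]
    linarith
  have habs := abs_le.mp hclose
  have hlow : 0 < (q.num : ℝ) + q.den * s := by nlinarith
  have hup : (q.num : ℝ) + q.den * s ≤ 2 * s * T := by nlinarith
  have hN : ((q.num ^ 2 - D * (q.den : ℤ) ^ 2 : ℤ) : ℝ) =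
      (q.num - q.den * s) * (q.num + q.den * s) := by
    push_cast
    rw [← hs2]
    ring
  have hN0 : q.num ^ 2 - D * (q.den : ℤ) ^ 2 ≠ 0 := by
    intro h
    obtain ⟨y, hy⟩ : ∃ y : ℤ, (D : ℤ) = y ^ 2 := by
      have hdvd : (q.den : ℤ) ^ 2 ∣ q.num ^ 2 := ⟨D, by linarith⟩
      obtain ⟨y, hy⟩ := (Int.pow_dvd_pow_iff two_ne_zero).mp hdvd
      refine ⟨y, ?_⟩
      have hden : (q.den : ℤ) ^ 2 ≠ 0 := by exact_mod_cast pow_ne_zero 2 q.den_ne_zero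
      apply mul_right_cancel₀ hden
      rw [hy] at h
      linarith
    refine hD ⟨y.natAbs, ?_⟩
    zify
    rw [← pow_two, sq_abs, hy]
  refine ⟨q.num, q.den, ?_, hN0, ?_, ?_, ?_⟩
  · rw [Int.isCoprime_iff_gcd_eq_one]
    exact q.reduced
  · have : (|((q.num ^ 2 - D * (q.den : ℤ) ^ 2 : ℤ) : ℝ)|) < M := by
      rw [hN, abs_mul, abs_of_pos hlow]
      calc _ ≤ 1 / T * (2 * s * T) := by gcongr
        _ = 2 * s := by field_simp
        _ < M := hsM
    exact_mod_cast this
  · have h1 : (1 : ℝ) ≤ |((q.num ^ 2 - D * (q.den : ℤ) ^ 2 : ℤ) : ℝ)| := by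
      exact_mod_cast Int.one_le_abs hN0
    rw [hN, abs_mul, abs_of_pos hlow] at h1
    have h2 : 1 ≤ 1 / T * (q.num + q.den * s) := h1.trans (by gcongr)
    rw [one_div, inv_mul_eq_div, le_div_iff₀ (by linarith), one_mul] at h2
    exact_mod_cast h2
  · calc _ ≤ 2 * s * T := by exact_mod_cast hup
      _ < M * T := by gcongr
      _ = _ := by rw [pow_succ, mul_comm]

/-- Coprimality makes `y` invertible modulo the norm, and `r` is `x / y` there; `x² ≡ D y²` then
gives `r² ≡ D`. -/
theorem exists_residue {D : ℕ} {x y : ℤ} (hxy : IsCoprime x y) (hN : x ^ 2 - D * y ^ 2 ≠ 0) :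
    ∃ r : ℕ, (r : ℤ) < |x ^ 2 - D * y ^ 2| ∧ x ^ 2 - D * y ^ 2 ∣ x - r * y ∧
      x ^ 2 - D * y ^ 2 ∣ (r : ℤ) ^ 2 - D := by
  set N := x ^ 2 - D * y ^ 2 with hNdef
  have hcop : IsCoprime y N := by
    have h := (hxy.pow_left (m := 2)).add_mul_left_left (-(D * y))
    rw [show x ^ 2 + y * -(D * y) = N by rw [hNdef]; ring] at h
    exact h.symm
  obtain ⟨u, v, huv⟩ := hcop
  have hr0 : 0 ≤ (x * u) % N := Int.emod_nonneg _ hN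
  obtain ⟨r, hr⟩ := Int.eq_ofNat_of_zero_le hr0
  have hdvd : N ∣ x - r * y := by
    refine ⟨x * v + x * u / N * y, ?_⟩
    have h1 := Int.emod_add_mul_ediv (x * u) N
    rw [hr] at h1
    linear_combination (-x) * huv - y * h1
  refine ⟨r, hr ▸ Int.emod_lt_abs _ hN, hdvd, ?_⟩
  have h2 : IsCoprime N (y ^ 2) := (IsCoprime.pow_left ⟨u, v, huv⟩).symm
  refine h2.dvd_of_dvd_mul_right ?_
  obtain ⟨k, hk⟩ := hdvd
  refine ⟨1 - k * (x + r * y), ?_⟩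
  linear_combination (-(x + r * y)) * hk - hNdef

/-- Two elements of `ℤ[√D]` generating the same ideal differ by a unit. -/
theorem exists_unit_of_same_key {D : ℕ} {x y x' y' N r : ℤ} (hN : N ≠ 0)
    (h : x ^ 2 - D * y ^ 2 = N) (h' : x' ^ 2 - D * y' ^ 2 = N)
    (hr : N ∣ x - r * y) (hr' : N ∣ x' - r * y') (hD : N ∣ r ^ 2 - D) :
    ∃ u v : ℤ, u ^ 2 - D * v ^ 2 = 1 ∧ x' = x * u + D * (y * v) ∧ y' = x * v + y * u := by
  -- The unit is `u + v√D = (x' + y'√D)(x - y√D) / N`; both coordinates of the numerator vanish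
  -- modulo `N` because `x ≡ r y`, `x' ≡ r y'` and `r² ≡ D`.
  obtain ⟨v, hv⟩ : N ∣ x * y' - y * x' := by
    obtain ⟨k, hk⟩ := hr
    obtain ⟨k', hk'⟩ := hr'
    exact ⟨k * y' - k' * y, by linear_combination y' * hk - y * hk'⟩
  obtain ⟨u, hu⟩ : N ∣ x * x' - D * (y * y') := by
    obtain ⟨k, hk⟩ := hr
    obtain ⟨k', hk'⟩ := hr'
    obtain ⟨c, hc⟩ := hD
    exact ⟨k * x' + r * y * k' + c * y * y',
      by linear_combination x' * hk + r * y * hk' + y * y' * hc⟩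
  refine ⟨u, v, ?_, ?_, ?_⟩
  · apply mul_left_cancel₀ (pow_ne_zero 2 hN)
    linear_combination -(x * x' - D * (y * y') + N * u) * hu + D * (x * y' - y * x' + N * v) * hv
      + (x' ^ 2 - D * y' ^ 2) * h + N * h'
  · apply mul_left_cancel₀ hN
    linear_combination x * hu + D * y * hv - x' * h
  · apply mul_left_cancel₀ hN
    linear_combination x * hv + y * hu - y' * h

theorem one_lt_and_le_of_one_lt_add_mul_sqrt {D : ℕ} {u v : ℤ} {B : ℝ}
    (h : u ^ 2 - D * v ^ 2 = 1) (h1 : 1 < u + v * √(D : ℝ)) (hB : u + v * √(D : ℝ) ≤ B) :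
    1 < u ∧ (u : ℝ) ≤ B := by
  set s := √(D : ℝ)
  have hs2 : s ^ 2 = D := Real.sq_sqrt (Nat.cast_nonneg D)
  have hmul : (u + v * s) * (u - v * s) = 1 := by
    have : (u : ℝ) ^ 2 - D * v ^ 2 = 1 := by exact_mod_cast h
    rw [← this, ← hs2]
    ring
  have hc0 : 0 < u - v * s := by
    by_contra hc
    nlinarith
  have hc1 : u - v * s < 1 := by nlinarith
  -- For `α > 1` with conjugate `1/α`, expanding this product gives `α + 1/α > 2`, that is `u > 1`.
  have hsum : (0 : ℝ) < (u + v * s - 1) * (1 - (u - v * s)) :=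
    mul_pos (by linarith) (by linarith)
  have hu : (1 : ℝ) < u := by nlinarith
  exact ⟨by exact_mod_cast hu, by linarith⟩

/-- An upper bound for the smallest nontrivial solution of Pell's equation. -/
theorem exists_pell_solution_le {D : ℕ} (hD : ¬ IsSquare D) :
    ∃ a : Pell.Solution₁ (D : ℤ), 1 < a.x ∧ a.x ≤ (pellScale D : ℤ) ^ ((pellKeys D).card + 1) := by
  set M := pellScale D with hM
  set s := √(D : ℝ) with hs
  have hs2 : s ^ 2 = D := Real.sq_sqrt (Nat.cast_nonneg D)
  choose x y hxy hN0 hNM hlow hup using fun i : ℕ => exists_coprime_approx hD i.succ_ne_zero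
  choose r hrN hr hrD using fun i => exists_residue (hxy i) (hN0 i)
  set N : ℕ → ℤ := fun i => x i ^ 2 - D * y i ^ 2 with hN
  set key : ℕ → (Σ _ : ℕ, ℕ × Bool) := fun i => ⟨r i, (N i).natAbs, decide (0 < N i)⟩ with hkey
  have hmaps : Set.MapsTo key (Finset.range ((pellKeys D).card + 1)) (pellKeys D) := by
    intro i _
    simp only [hkey, pellKeys, Finset.coe_sigma, Set.mem_sigma_iff, Finset.coe_product,
      Set.mem_prod, Finset.mem_coe, Finset.mem_range, Finset.mem_univ, and_true, Nat.mem_divisors]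
    refine ⟨by have := (hrN i).trans (hNM i); exact_mod_cast this,
      Int.natAbs_dvd_natAbs.mpr (hrD i), ?_⟩
    rw [Int.natAbs_ne_zero, sub_ne_zero]
    intro h
    exact hD ⟨r i, by rw [← pow_two]; exact_mod_cast h.symm⟩
  -- Pigeonhole: there is one more approximation than keys, and two with the same key differ by a
  -- unit.
  obtain ⟨i, hi, j, hj, hij, heq⟩ :=
    Finset.exists_ne_map_eq_of_card_lt_of_maps_to (by simp) hmaps
  wlog hlt : i < j generalizing i j
  · exact this j hj i hi hij.symm heq.symm (by omega)
  have hrr : r i = r j := congrArg Sigma.fst heq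
  have hNN : N i = N j := by
    simp only [hkey, Sigma.mk.injEq, heq_eq_eq, Prod.mk.injEq, decide_eq_decide] at heq
    have := hN0 i
    have := hN0 j
    omega
  obtain ⟨u, v, huv, hx', hy'⟩ := exists_unit_of_same_key (N := N i) (r := r i) (hN0 i) rfl
    (x' := x j) (y' := y j) hNN.symm (hr i) (by rw [hrr, hNN]; exact hr j) (hrD i)
  have hmul : (x j + y j * s : ℝ) = (x i + y i * s) * (u + v * s) := by
    rw [hx', hy']
    push_cast
    rw [← hs2]
    ring
  have hM1 : (1 : ℝ) ≤ M := by
    have : 1 ≤ M := by simp [hM, pellScale]; omega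
    exact_mod_cast this
  have hpos : (0 : ℝ) < (M : ℝ) ^ (i + 1) := by positivity
  have hαi : 0 < x i + y i * s := hpos.trans_le (hlow i)
  have h1 : 1 < u + v * s := by
    by_contra hle
    have : x j + y j * s ≤ x i + y i * s := by
      rw [hmul]
      exact mul_le_of_le_one_right hαi.le (not_lt.mp hle)
    have h2 : (M : ℝ) ^ (i + 1 + 1) ≤ (M : ℝ) ^ (j + 1) := pow_le_pow_right₀ hM1 (by omega)
    have h3 : (M : ℝ) ^ (j + 1) ≤ x j + y j * s := hlow j
    have h4 : x i + y i * s < (M : ℝ) ^ (i + 1 + 1) := hup i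
    linarith
  -- The numerator is below `M^(j+2)` and the denominator at least `M^(i+1)`, so the unit is at most
  -- `M^(j+1-i)`, with `j` at most the number of keys.
  have hB : u + v * s ≤ (M : ℝ) ^ ((pellKeys D).card + 1) := by
    have h2 : (M : ℝ) ^ (i + 1) * (u + v * s) ≤ (M : ℝ) ^ (i + 1) * (M : ℝ) ^ (j + 1 - i) := by
      rw [← pow_add, show i + 1 + (j + 1 - i) = j + 1 + 1 by omega]
      refine le_trans ?_ (hup j).le
      rw [hmul]
      exact mul_le_mul_of_nonneg_right (hlow i) (by linarith)
    refine (le_of_mul_le_mul_left h2 hpos).trans (pow_le_pow_right₀ hM1 ?_)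
    have := Finset.mem_range.mp hj
    omega
  obtain ⟨hu1, huB⟩ := one_lt_and_le_of_one_lt_add_mul_sqrt huv h1 hB
  exact ⟨Pell.Solution₁.mk u v huv, hu1, by simpa using (by exact_mod_cast huB)⟩

/-! ### Powers of a Pell solution and divisibility by 2 -/

section PellPowers

variable {D : ℤ} (a : Pell.Solution₁ D)

theorem pell_x_pow_add_two (n : ℕ) : (a ^ (n + 2)).x = 2 * a.x * (a ^ (n + 1)).x - (a ^ n).x := by
  have h : a ^ (n + 2) = a ^ n * a * a := by rw [pow_succ, pow_succ]
  have h' : a ^ (n + 1) = a ^ n * a := pow_succ _ _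
  rw [h, h']
  simp only [Pell.Solution₁.x_mul, Pell.Solution₁.y_mul]
  linear_combination (-(a ^ n).x) * a.prop

theorem pell_x_pow_two_mul (n : ℕ) : (a ^ (2 * n)).x = 2 * (a ^ n).x ^ 2 - 1 := by
  rw [two_mul, pow_add, Pell.Solution₁.x_mul]
  linear_combination -(a ^ n).prop

theorem pell_x_pow_odd (n : ℕ) : ∃ k : ℤ, (a ^ (2 * n + 1)).x = a.x * (2 * k + 1) := by
  induction n with
  | zero => exact ⟨0, by simp⟩
  | succ n ih =>
    obtain ⟨k, hk⟩ := ih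
    refine ⟨(a ^ (2 * n + 2)).x - k - 1, ?_⟩
    rw [show 2 * (n + 1) + 1 = 2 * n + 1 + 2 by ring, pell_x_pow_add_two, hk]
    ring

/-- Modulo `a.x + 1` the recurrence makes the `x`-coordinates alternate between 1 and -1. The
recurrence mixes parities, so both are carried through one induction. The odd cofactor lets a power
of 2 descend from `(a ^ (2 * n + 1)).x + 1` to `a.x + 1`. -/
theorem pell_x_pow_odd_add_one (n : ℕ) :
    (∃ k : ℤ, (a ^ (2 * n)).x = 1 + (a.x + 1) * k) ∧
      ∃ k : ℤ, (a ^ (2 * n + 1)).x + 1 = (a.x + 1) * (2 * k + 1) := by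
  induction n with
  | zero => exact ⟨⟨0, by simp⟩, ⟨0, by simp⟩⟩
  | succ n ih =>
    obtain ⟨⟨k, hk⟩, l, hl⟩ := ih
    have heven : ∃ k : ℤ, (a ^ (2 * (n + 1))).x = 1 + (a.x + 1) * k := by
      refine ⟨2 * a.x * (2 * l + 1) - 2 - k, ?_⟩
      rw [show 2 * (n + 1) = 2 * n + 2 by ring, pell_x_pow_add_two, hk]
      linear_combination 2 * a.x * hl
    obtain ⟨z, hz⟩ := heven
    refine ⟨⟨z, hz⟩, a.x * z - l, ?_⟩
    rw [show 2 * (n + 1) + 1 = 2 * n + 1 + 2 by ring, pell_x_pow_add_two,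
      show 2 * n + 1 + 1 = 2 * (n + 1) by ring, hz]
    linear_combination -hl

end PellPowers

/-! ### Bounding the exponent `m` -/

theorem eq_two_pow_of_mul_odd_eq {t k : ℤ} {j : ℕ} (ht : 0 < t) (h : t * (2 * k + 1) = 2 ^ j) :
    t = 2 ^ j := by
  have hcop : IsCoprime (2 * k + 1) ((2 : ℤ) ^ j) := by
    refine IsCoprime.pow_right ⟨1, -k, by ring⟩
  have hunit : IsUnit (2 * k + 1) := hcop.isUnit_of_dvd' dvd_rfl ⟨t, by rw [← h]; ring⟩
  have hpos : 0 < 2 * k + 1 := by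
    have : 0 < t * (2 * k + 1) := by rw [h]; positivity
    exact (mul_pos_iff_of_pos_left ht).mp this
  rcases Int.isUnit_iff.mp hunit with h1 | h1
  · rw [← h, h1, mul_one]
  · omega

theorem not_isSquare_of_squarefree {d : ℕ} (hd : Squarefree d) (hd2 : 2 ≤ d) : ¬ IsSquare d := by
  rintro ⟨k, hk⟩
  have := Nat.isUnit_iff.mp (hd k (hk ▸ dvd_rfl))
  subst this
  omega

/-- The exponent `m` in `d y² + 1 = 2 ^ m` is bounded in terms of `d`: the equation yields the
fundamental solution of a Pell equation. -/
theorem two_pow_le_of_mul_sq_add_one_eq {d m y : ℕ} (hd : Squarefree d) (hd2 : 2 ≤ d) (hm : m ≠ 0)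
    (h : d * y ^ 2 + 1 = 2 ^ m) :
    ∃ D ≤ 2 * d, ¬ IsSquare D ∧ 2 ^ m ≤ pellScale D ^ (2 * ((pellKeys D).card + 1)) := by
  have hZ : (d : ℤ) * y ^ 2 + 1 = 2 ^ m := by exact_mod_cast h
  rcases Nat.even_or_odd' m with ⟨k, rfl | rfl⟩
  · have hsq := not_isSquare_of_squarefree hd hd2
    refine ⟨d, by omega, hsq, ?_⟩
    obtain ⟨a₁, ha₁⟩ := Pell.IsFundamental.exists_of_not_isSquare (d := (d : ℤ)) (by omega)
      (by simpa using hsq)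
    obtain ⟨b, hb1, hb⟩ := exists_pell_solution_le hsq
    obtain ⟨n, hn⟩ := ha₁.eq_pow_of_nonneg (a := Pell.Solution₁.mk (2 ^ k) y (by
      rw [← pow_mul, mul_comm k 2]; linarith)) (by simp) (by simp)
    have hx : (2 : ℤ) ^ k = (a₁ ^ n).x := by rw [← hn]; simp
    have hx₁ : a₁.x = 2 ^ k := by
      rcases Nat.even_or_odd' n with ⟨l, rfl | rfl⟩
      -- An even power has odd `x`-coordinate, whereas `2^k` is even because `m ≠ 0`.
      · exfalso
        rw [pell_x_pow_two_mul] at hx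
        obtain ⟨k, rfl⟩ := Nat.exists_eq_succ_of_ne_zero (by omega : k ≠ 0)
        rw [pow_succ] at hx
        omega
      · obtain ⟨c, hc⟩ := pell_x_pow_odd a₁ l
        exact eq_two_pow_of_mul_odd_eq ha₁.x_pos (hc.symm.trans hx.symm)
    have hle : (2 : ℤ) ^ k ≤ (pellScale d : ℤ) ^ ((pellKeys d).card + 1) :=
      hx₁ ▸ (ha₁.x_le_x hb1).trans hb
    have hle' : 2 ^ k ≤ pellScale d ^ ((pellKeys d).card + 1) := by exact_mod_cast hle
    rw [mul_comm 2 k, mul_comm 2, pow_mul, pow_mul]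
    exact Nat.pow_le_pow_left hle' 2
  · have hdodd : Odd d := by
      by_contra hev
      rw [Nat.not_odd_iff_even] at hev
      obtain ⟨c, rfl⟩ := hev
      rw [show (c + c) * y ^ 2 = 2 * (c * y ^ 2) by ring, pow_succ 2] at h
      omega
    have hsq : ¬ IsSquare (2 * d) := by
      rintro ⟨c, hc⟩
      have hc2 : Even c := by
        have : Even (c * c) := hc ▸ even_two_mul d
        rcases Nat.even_mul.mp this with h | h <;> exact h
      obtain ⟨e, rfl⟩ := hc2
      have : d = 2 * (e * e) := by nlinarith
      rw [this] at hdodd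
      exact (Nat.not_odd_iff_even.mpr (even_two_mul _)) hdodd
    refine ⟨2 * d, le_rfl, hsq, ?_⟩
    obtain ⟨a₁, ha₁⟩ := Pell.IsFundamental.exists_of_not_isSquare (d := ((2 * d : ℕ) : ℤ))
      (by push_cast; omega) (by rwa [Int.isSquare_natCast_iff])
    obtain ⟨b, hb1, hb⟩ := exists_pell_solution_le hsq
    -- For odd `m = 2k + 1` the solution is the square of `√(2^m) + y√d`, namely `2^(m+1) - 1 +
    -- 2^(k+1) y √(2d)`.
    obtain ⟨n, hn⟩ := ha₁.eq_pow_of_nonneg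
      (a := Pell.Solution₁.mk (2 ^ (2 * k + 2) - 1) (2 ^ (k + 1) * y) (by
        push_cast
        have e1 : (2 : ℤ) ^ (2 * k + 2) = 2 * 2 ^ (2 * k + 1) := by ring
        have e2 : ((2 : ℤ) ^ (k + 1)) ^ 2 = 2 * 2 ^ (2 * k + 1) := by ring
        rw [mul_pow, e1, e2]
        linear_combination (-4 * 2 ^ (2 * k + 1)) * hZ))
      (by
        have : (1 : ℤ) < 2 ^ (2 * k + 2) := one_lt_pow₀ (by norm_num) (by omega)
        simpa using this) (by simp)
    have hx : (2 : ℤ) ^ (2 * k + 2) - 1 = (a₁ ^ n).x := by rw [← hn]; simp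
    have hx₁ : a₁.x + 1 = 2 ^ (2 * k + 2) := by
      rcases Nat.even_or_odd' n with ⟨l, rfl | rfl⟩
      · exfalso
        rw [pell_x_pow_two_mul] at hx
        -- An even power would make `2^(2k+1)`, of odd exponent, a perfect square.
        have hsq2 : (a₁ ^ l).x ^ 2 = 2 ^ (2 * k + 1) := by
          rw [pow_succ] at hx
          linarith
        have hdvd : (2 : ℤ) ^ k ∣ (a₁ ^ l).x := by
          rw [← Int.pow_dvd_pow_iff two_ne_zero, hsq2]
          exact ⟨2, by ring⟩
        obtain ⟨c, hc⟩ := hdvd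
        have hc2 : c ^ 2 = 2 := by
          have hp : ((2 : ℤ) ^ k) ^ 2 ≠ 0 := by positivity
          apply mul_left_cancel₀ hp
          rw [← mul_pow, ← hc, hsq2]
          ring
        have hc3 : c < 2 := by nlinarith
        have hc4 : -2 < c := by nlinarith
        interval_cases c <;> omega
      · obtain ⟨-, c, hc⟩ := pell_x_pow_odd_add_one a₁ l
        exact eq_two_pow_of_mul_odd_eq (by linarith [ha₁.x_pos]) (hc.symm.trans (by linarith))
    have hle : a₁.x ≤ (pellScale (2 * d) : ℤ) ^ ((pellKeys (2 * d)).card + 1) :=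
      (ha₁.x_le_x hb1).trans hb
    have hle1 : (2 : ℤ) ^ (2 * k + 1) ≤ a₁.x := by
      have h1 : (1 : ℤ) ≤ 2 ^ (2 * k + 1) := one_le_pow₀ (by norm_num)
      have h2 : (2 : ℤ) ^ (2 * k + 2) = 2 * 2 ^ (2 * k + 1) := by ring
      linarith
    have hle' : 2 ^ (2 * k + 1) ≤ pellScale (2 * d) ^ ((pellKeys (2 * d)).card + 1) := by
      exact_mod_cast hle1.trans hle
    exact hle'.trans (Nat.pow_le_pow_right (by simp [pellScale]) (by omega))

/-! ### Squarefree parts of `2^m - 1` have density zero -/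

/-- The squarefree parts `≥ 2` of the numbers `2 ^ m - 1`. -/
def mersenneSquarefreeParts : Set ℕ :=
  {d ∈ squarefreeNat | ∃ m y : ℕ, m ≠ 0 ∧ d * y ^ 2 + 1 = 2 ^ m}

theorem eq_of_squarefree_mul_sq_eq {d e y z : ℕ} (hd : Squarefree d) (he : Squarefree e)
    (hy : y ≠ 0) (h : d * y ^ 2 = e * z ^ 2) : d = e := by
  obtain ⟨k, hk⟩ := exists_nat_sq_of_squarefree_mul_sq_eq (n := d) he (z := (z : ℚ) / y) (by
    have h' : (d : ℚ) * y ^ 2 = e * z ^ 2 := by exact_mod_cast h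
    have hy' : (y : ℚ) ≠ 0 := by exact_mod_cast hy
    rw [div_pow, mul_div_assoc', ← h']
    field_simp)
  have : k = 1 := Nat.isUnit_iff.mp (hd k ⟨e, by rw [← hk]; ring⟩)
  simpa [this] using hk.symm

theorem pellScale_mono : Monotone pellScale := fun _ _ h => by
  have := Nat.sqrt_le_sqrt h
  simp only [pellScale]
  omega

/-- The bound for the exponent `m` in terms of `pellScale`. -/
noncomputable def exponentBound (t : ℝ) : ℝ := 1026 * t ^ (5 / 3 : ℝ) * Real.log t / Real.log 2

theorem le_exponentBound {D m : ℕ} (hD : ¬ IsSquare D)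
    (h : 2 ^ m ≤ pellScale D ^ (2 * ((pellKeys D).card + 1))) :
    (m : ℝ) ≤ exponentBound (pellScale D) := by
  have hM : (1 : ℝ) ≤ pellScale D := by
    have : 1 ≤ pellScale D := by simp [pellScale]; omega
    exact_mod_cast this
  have hcard : ((pellKeys D).card : ℝ) ≤ 512 * (pellScale D : ℝ) ^ (5 / 3 : ℝ) := by
    have h3 : ((pellKeys D).card : ℝ) ^ 3 ≤ 8 ^ 9 * (pellScale D : ℝ) ^ 5 := by
      exact_mod_cast card_pellKeys_pow_three_le hD
    refine le_of_pow_le_pow_left₀ three_ne_zero (by positivity) (h3.trans_eq ?_)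
    rw [mul_pow, ← Real.rpow_natCast (_ ^ (5 / 3 : ℝ)), ← Real.rpow_mul (by positivity),
      ← Real.rpow_natCast _ 5]
    norm_num
  have h1 : (1 : ℝ) ≤ (pellScale D : ℝ) ^ (5 / 3 : ℝ) := Real.one_le_rpow hM (by norm_num)
  have hlog : (m : ℝ) * Real.log 2 ≤ 2 * ((pellKeys D).card + 1) * Real.log (pellScale D) := by
    have h2 : ((2 : ℝ) ^ m) ≤ (pellScale D : ℝ) ^ (2 * ((pellKeys D).card + 1)) := by
      exact_mod_cast h
    have := Real.log_le_log (by positivity) h2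
    rw [Real.log_pow, Real.log_pow] at this
    exact_mod_cast this
  have hlogM : 0 ≤ Real.log (pellScale D) := Real.log_nonneg hM
  rw [exponentBound, le_div_iff₀ (Real.log_pos one_lt_two)]
  refine hlog.trans (mul_le_mul_of_nonneg_right ?_ hlogM)
  -- The constant is `1026 = 2 (512 + 1)`, where `512³ = 8^9` and the 1 is absorbed by `t^(5/3) ≥
  -- 1`.
  linarith

theorem exponentBound_mono {s t : ℝ} (hs : 1 ≤ s) (hst : s ≤ t) :
    exponentBound s ≤ exponentBound t := by
  have := Real.log_nonneg hs
  have := Real.log_pos one_lt_two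
  have := Real.log_le_log (by linarith) hst
  have : 0 ≤ s := by linarith
  have : 0 ≤ t := by linarith
  unfold exponentBound
  gcongr

/-- Choosing an exponent `m` for each `d` is injective, since `2^m - 1` determines its squarefree
part. The Pell discriminant is at most `2d`, whence the argument `2 * ⌊X⌋₊`. -/
theorem ncard_mersenneSquarefreeParts_le (X : ℝ) :
    ({d ∈ mersenneSquarefreeParts | (d : ℝ) ≤ X}.ncard : ℝ) ≤
      exponentBound (pellScale (2 * ⌊X⌋₊)) + 1 := by
  have hpos : (1 : ℝ) ≤ pellScale (2 * ⌊X⌋₊) := by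
    have : 1 ≤ pellScale (2 * ⌊X⌋₊) := by simp [pellScale]; omega
    exact_mod_cast this
  have hG : 0 ≤ exponentBound (pellScale (2 * ⌊X⌋₊)) := by
    have h0 : exponentBound 1 = 0 := by simp [exponentBound]
    exact h0 ▸ exponentBound_mono le_rfl hpos
  have hex (d : ℕ) : ∃ m : ℕ, d ∈ {d ∈ mersenneSquarefreeParts | (d : ℝ) ≤ X} →
      m ≠ 0 ∧ (∃ y : ℕ, d * y ^ 2 + 1 = 2 ^ m) ∧
        m < ⌊exponentBound (pellScale (2 * ⌊X⌋₊))⌋₊ + 1 := by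
    by_cases hd : d ∈ {d ∈ mersenneSquarefreeParts | (d : ℝ) ≤ X}
    · obtain ⟨⟨⟨hd2, hdsf⟩, m, y, hm, hy⟩, hdX⟩ := hd
      refine ⟨m, fun _ => ⟨hm, ⟨y, hy⟩, ?_⟩⟩
      obtain ⟨D, hD, hDsq, hle⟩ := two_pow_le_of_mul_sq_add_one_eq hdsf hd2 hm hy
      rw [Nat.lt_succ_iff]
      apply Nat.le_floor
      refine (le_exponentBound hDsq hle).trans (exponentBound_mono ?_ ?_)
      · have : 1 ≤ pellScale D := by simp [pellScale]; omega
        exact_mod_cast this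
      · have hdf : d ≤ ⌊X⌋₊ := Nat.le_floor hdX
        exact_mod_cast pellScale_mono (by omega)
    · exact ⟨0, fun h => absurd h hd⟩
  choose m hm using hex
  have hinj : Set.InjOn m {d ∈ mersenneSquarefreeParts | (d : ℝ) ≤ X} := by
    intro d hd e he hde
    obtain ⟨hm0, ⟨y, hy⟩, -⟩ := hm d hd
    obtain ⟨-, ⟨z, hz⟩, -⟩ := hm e he
    refine eq_of_squarefree_mul_sq_eq (y := y) (z := z) hd.1.1.2 he.1.1.2 ?_ ?_
    · rintro rfl
      have := Nat.one_lt_two_pow hm0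
      simp at hy
      omega
    · rw [hde] at hy
      omega
  have hcard := Set.ncard_le_ncard_of_injOn m
    (t := ((Finset.range (⌊exponentBound (pellScale (2 * ⌊X⌋₊))⌋₊ + 1) : Finset ℕ) : Set ℕ))
    (fun d hd => by simpa using (hm d hd).2.2) hinj (Finset.finite_toSet _)
  rw [Set.ncard_coe_finset, Finset.card_range] at hcard
  have hfl := Nat.floor_le hG
  have : ({d ∈ mersenneSquarefreeParts | (d : ℝ) ≤ X}.ncard : ℝ) ≤
      (⌊exponentBound (pellScale (2 * ⌊X⌋₊))⌋₊ : ℝ) + 1 := by exact_mod_cast hcard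
  linarith

theorem tendsto_exponentBound_div_sq :
    Tendsto (fun t : ℝ => (exponentBound t + 1) / t ^ 2) atTop (𝓝 0) := by
  have h1 : Tendsto (fun t : ℝ => Real.log t / t ^ (1 / 3 : ℝ)) atTop (𝓝 0) :=
    (isLittleO_log_rpow_atTop (by norm_num)).tendsto_div_nhds_zero
  have h2 : Tendsto (fun t : ℝ => (1 : ℝ) / t ^ 2) atTop (𝓝 0) := by
    simpa using (tendsto_pow_neg_atTop (𝕜 := ℝ) two_ne_zero)
  have h3 := (h1.const_mul (1026 / Real.log 2)).add h2
  rw [mul_zero, zero_add] at h3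
  refine h3.congr' ?_
  filter_upwards [eventually_gt_atTop 0] with t ht
  have hp : t ^ 2 = t ^ (5 / 3 : ℝ) * t ^ (1 / 3 : ℝ) := by
    rw [← Real.rpow_add ht, ← Real.rpow_natCast]
    norm_num
  rw [exponentBound, add_div, hp]
  have : 0 < t ^ (5 / 3 : ℝ) := by positivity
  have : 0 < t ^ (1 / 3 : ℝ) := by positivity
  have := Real.log_pos one_lt_two
  field_simp

theorem tendsto_ncard_mersenneSquarefreeParts :
    Tendsto (fun X : ℝ => ({d ∈ mersenneSquarefreeParts | (d : ℝ) ≤ X}.ncard : ℝ) / X)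
      atTop (𝓝 0) := by
  have hscale : Tendsto (fun X : ℝ => (pellScale (2 * ⌊X⌋₊) : ℝ)) atTop atTop := by
    refine tendsto_atTop_mono' _ ?_ (Real.tendsto_sqrt_atTop)
    filter_upwards [eventually_ge_atTop 1] with X hX
    have h1 := two_mul_sqrt_lt_pellScale (2 * ⌊X⌋₊)
    have h2 : X ≤ ((2 * ⌊X⌋₊ : ℕ) : ℝ) := by
      have := Nat.lt_floor_add_one X
      have h4 : (1 : ℝ) ≤ ⌊X⌋₊ := by exact_mod_cast Nat.le_floor (by simpa using hX)
      push_cast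
      linarith
    have h3 := Real.sqrt_le_sqrt h2
    have := Real.sqrt_nonneg X
    linarith
  have hlim := (tendsto_exponentBound_div_sq.comp hscale).const_mul 32
  rw [mul_zero] at hlim
  refine squeeze_zero' ?_ ?_ hlim
  · filter_upwards [eventually_ge_atTop 0] with X hX
    positivity
  · filter_upwards [eventually_ge_atTop 1] with X hX
    have hb := ncard_mersenneSquarefreeParts_le X
    -- This trades division by `X` for division by the squared scale, against which `t^(5/3) log t`
    -- is negligible.
    have hsq : (pellScale (2 * ⌊X⌋₊) : ℝ) ^ 2 ≤ 32 * X := by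
      have h1 : ((2 * ⌊X⌋₊).sqrt : ℝ) ^ 2 ≤ 2 * X := by
        have h2 : (((2 * ⌊X⌋₊).sqrt ^ 2 : ℕ) : ℝ) ≤ ((2 * ⌊X⌋₊ : ℕ) : ℝ) := by
          exact_mod_cast Nat.sqrt_le' _
        have h3 := Nat.floor_le (by linarith : 0 ≤ X)
        push_cast at h2
        linarith
      rw [pellScale]
      push_cast
      nlinarith [sq_nonneg (((2 * ⌊X⌋₊).sqrt : ℝ) - 1)]
    have hMpos : (0 : ℝ) < (pellScale (2 * ⌊X⌋₊) : ℝ) ^ 2 := by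
      have : 0 < pellScale (2 * ⌊X⌋₊) := by simp [pellScale]
      positivity
    have hnum : 0 ≤ exponentBound (pellScale (2 * ⌊X⌋₊)) + 1 := le_trans (by positivity) hb
    simp only [Function.comp]
    rw [div_le_iff₀ (by linarith)]
    refine hb.trans ?_
    rw [mul_div_assoc', div_mul_eq_mul_div, le_div_iff₀ hMpos]
    nlinarith

/-! ### Squarefree numbers in odd classes modulo 8 -/

section SquarefreeCount

open ArithmeticFunction

theorem sq_dvd_sq_mul_squarefree_iff {a b s : ℕ} (hs : Squarefree s) :
    a ^ 2 ∣ b ^ 2 * s ↔ a ∣ b := by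
  constructor
  · intro h
    rcases Nat.eq_zero_or_pos (a.gcd b) with h0 | h0
    · rw [Nat.gcd_eq_zero_iff] at h0
      simp [h0.1, h0.2]
    obtain ⟨a', b', hcop, ha, hb⟩ := Nat.exists_coprime a b
    set g := a.gcd b
    have h1 : a' ^ 2 ∣ b' ^ 2 * s := by
      rw [ha, hb, mul_pow, mul_pow, mul_right_comm] at h
      exact Nat.dvd_of_mul_dvd_mul_right (by positivity) h
    have h2 : a' ^ 2 ∣ s := (hcop.pow 2 2).dvd_of_dvd_mul_left h1
    have h3 : a' = 1 := Nat.isUnit_iff.mp (hs a' (by rwa [← pow_two]))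
    rw [ha, h3, one_mul]
    exact Nat.gcd_dvd_right a b
  · intro h
    exact (pow_dvd_pow_of_dvd h 2).mul_right s

/-- Writing `n = b² s` with `s` squarefree, `a² ∣ n` means `a ∣ b`, and the sum of `μ` over the
divisors of `b` detects `b = 1`. -/
theorem sum_moebius_sq_dvd {n N : ℕ} (hn : n ≠ 0) (hnN : n ≤ N) :
    ∑ a ∈ Finset.Icc 1 N with a ^ 2 ∣ n, moebius a = if Squarefree n then 1 else 0 := by
  obtain ⟨s, b, hs0, hb0, hsb, hs⟩ := Nat.sq_mul_squarefree_of_pos (Nat.pos_of_ne_zero hn)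
  have hset : {a ∈ Finset.Icc 1 N | a ^ 2 ∣ n} = b.divisors := by
    ext a
    rw [Finset.mem_filter, Finset.mem_Icc, Nat.mem_divisors, ← hsb,
      sq_dvd_sq_mul_squarefree_iff hs]
    refine ⟨fun h => ⟨h.2, hb0.ne'⟩, fun h => ⟨⟨Nat.pos_of_dvd_of_pos h.1 hb0, ?_⟩, h.1⟩⟩
    have h1 := Nat.le_of_dvd hb0 h.1
    nlinarith
  have hiff : Squarefree n ↔ b = 1 := by
    constructor
    · intro h
      exact Nat.isUnit_iff.mp (h b ⟨s, by rw [← hsb]; ring⟩)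
    · rintro rfl
      rw [← hsb]
      simpa using hs
  rw [hset, ← coe_mul_zeta_apply, moebius_mul_coe_zeta, one_apply]
  simp [hiff]

/-- The number of `1 ≤ n ≤ N` divisible by `a ^ 2` with `n ≡ c` modulo `8`. -/
def classCount (c a N : ℕ) : ℕ := {n ∈ Finset.Icc 1 N | n % 8 = c ∧ a ^ 2 ∣ n}.card

/-- The number of squarefree `1 ≤ n ≤ N` with `n ≡ c` modulo `8`. -/
def squarefreeClassCount (c N : ℕ) : ℕ := {n ∈ Finset.Icc 1 N | n % 8 = c ∧ Squarefree n}.card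

theorem squarefreeClassCount_eq_sum (c N : ℕ) :
    (squarefreeClassCount c N : ℤ) = ∑ a ∈ Finset.Icc 1 N, moebius a * classCount c a N := by
  have h1 : (squarefreeClassCount c N : ℤ) = ∑ n ∈ Finset.Icc 1 N with n % 8 = c,
      ∑ a ∈ Finset.Icc 1 N, if a ^ 2 ∣ n then moebius a else 0 := by
    rw [squarefreeClassCount, ← Finset.filter_filter, Finset.card_filter]
    push_cast
    refine Finset.sum_congr rfl fun n hn => ?_
    rw [Finset.mem_filter, Finset.mem_Icc] at hn
    rw [← Finset.sum_filter, sum_moebius_sq_dvd (by omega) hn.1.2]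
  rw [h1, Finset.sum_comm]
  refine Finset.sum_congr rfl fun a _ => ?_
  rw [← Finset.sum_filter, Finset.sum_const, Finset.filter_filter, classCount, nsmul_eq_mul,
    mul_comm]

theorem classCount_even {c a : ℕ} (hc : Odd c) (ha : Even a) (N : ℕ) : classCount c a N = 0 := by
  rw [classCount, Finset.card_eq_zero, Finset.filter_eq_empty_iff]
  rintro n - ⟨h1, h2⟩
  have h3 : 2 ∣ n := (dvd_pow ha.two_dvd two_ne_zero).trans h2
  rw [Nat.odd_iff] at hc
  omega

theorem card_filter_modEq_bounds {r : ℕ} (hr : 0 < r) (v N : ℕ) :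
    |(({n ∈ Finset.Ioc 0 N | n ≡ v [MOD r]}.card : ℕ) : ℝ) - N / r| ≤ 1 := by
  have h := Nat.Ioc_filter_modEq_card 0 N hr v
  have hr' : (0 : ℚ) < r := by exact_mod_cast hr
  have hle : ⌊(((0 : ℕ) : ℚ) - v) / r⌋ ≤ ⌊((N : ℚ) - v) / r⌋ := by
    gcongr
    simp
  rw [max_eq_left (by linarith)] at h
  have hQ : (({n ∈ Finset.Ioc 0 N | n ≡ v [MOD r]}.card : ℕ) : ℚ) =
      ⌊((N : ℚ) - v) / r⌋ - ⌊(((0 : ℕ) : ℚ) - v) / r⌋ := by exact_mod_cast h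
  have key : |(({n ∈ Finset.Ioc 0 N | n ≡ v [MOD r]}.card : ℕ) : ℚ) - N / r| ≤ 1 := by
    have hdiff : ((N : ℚ) - v) / r - (((0 : ℕ) : ℚ) - v) / r = N / r := by
      push_cast
      ring
    have h1 := Int.floor_le (((N : ℚ) - v) / r)
    have h2 := Int.lt_floor_add_one (((N : ℚ) - v) / r)
    have h3 := Int.floor_le ((((0 : ℕ) : ℚ) - v) / r)
    have h4 := Int.lt_floor_add_one ((((0 : ℕ) : ℚ) - v) / r)
    rw [hQ, abs_le]
    constructor <;> linarith
  have keyR := (Rat.cast_le (K := ℝ)).mpr key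
  push_cast at keyR
  exact keyR

/-- For odd `a` the two conditions form a single class modulo `8 a²` by the Chinese remainder
theorem. -/
theorem abs_classCount_sub_le {c a : ℕ} (hc : c < 8) (ha : Odd a) (N : ℕ) :
    |(classCount c a N : ℝ) - N / (8 * a ^ 2 : ℕ)| ≤ 1 := by
  have hcop : Nat.Coprime 8 (a ^ 2) := by
    have : Nat.Coprime 2 a := (Nat.coprime_two_left).mpr ha
    exact this.pow 3 2
  obtain ⟨v, hv1, hv2⟩ := Nat.chineseRemainder hcop c 0
  have heq : classCount c a N = {n ∈ Finset.Ioc 0 N | n ≡ v [MOD 8 * a ^ 2]}.card := by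
    rw [classCount]
    congr 1
    ext n
    rw [Finset.mem_filter, Finset.mem_filter, ← Nat.modEq_and_modEq_iff_modEq_mul hcop,
      Finset.mem_Icc, Finset.mem_Ioc, Nat.succ_le_iff]
    refine and_congr_right fun _ => and_congr ?_ ?_
    · rw [Nat.ModEq.comm] at hv1
      have : n % 8 = c ↔ n ≡ c [MOD 8] := by rw [Nat.ModEq, Nat.mod_eq_of_lt hc]
      rw [this]
      exact ⟨fun h => h.trans hv1, fun h => h.trans hv1.symm⟩
    · rw [← Nat.modEq_zero_iff_dvd]
      exact ⟨fun h => h.trans hv2.symm, fun h => h.trans hv2⟩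
  rw [heq]
  have := ha.pos
  exact card_filter_modEq_bounds (by positivity) v N

theorem classCount_le (c a N : ℕ) : (classCount c a N : ℝ) ≤ N / (a : ℝ) ^ 2 := by
  have h1 : classCount c a N ≤ N / a ^ 2 := by
    rw [← Nat.Ioc_filter_dvd_card_eq_div, classCount]
    refine Finset.card_le_card fun n hn => ?_
    simp only [Finset.mem_filter, Finset.mem_Icc, Finset.mem_Ioc] at hn ⊢
    exact ⟨⟨by omega, hn.1.2⟩, hn.2.2⟩
  calc (classCount c a N : ℝ) ≤ ((N / a ^ 2 : ℕ) : ℝ) := by exact_mod_cast h1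
    _ ≤ N / (a : ℝ) ^ 2 := by rw [← Nat.cast_pow]; exact Nat.cast_div_le

/-- The terms `μ(a) / a²` for odd `a`. -/
noncomputable def oddMoebiusTerm (a : ℕ) : ℝ := if Odd a then (moebius a : ℝ) / a ^ 2 else 0

theorem abs_moebius_real_le_one (a : ℕ) : |(moebius a : ℝ)| ≤ 1 := by
  exact_mod_cast (abs_moebius_le_one (n := a))

theorem summable_one_div_sq : Summable fun a : ℕ => (1 : ℝ) / (a : ℝ) ^ 2 :=
  Real.summable_one_div_nat_pow.mpr one_lt_two

theorem abs_oddMoebiusTerm_le (a : ℕ) : |oddMoebiusTerm a| ≤ 1 / (a : ℝ) ^ 2 := by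
  rw [oddMoebiusTerm]
  split_ifs
  · rw [abs_div, abs_of_nonneg (by positivity : (0 : ℝ) ≤ (a : ℝ) ^ 2)]
    gcongr
    exact abs_moebius_real_le_one a
  · simp

theorem tsum_oddMoebiusTerm_pos : 0 < ∑' a, oddMoebiusTerm a := by
  have hzeta : HasSum (fun a : ℕ => (1 : ℝ) / (a : ℝ) ^ 2) (Real.pi ^ 2 / 6) := hasSum_zeta_two
  -- The minorant equals 1 at `a = 1` and `-1/a²` elsewhere, with sum `2 - π²/6 > 0`.
  have hlow := (hasSum_ite_eq 1 (2 : ℝ)).sub hzeta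
  have hsum : Summable oddMoebiusTerm :=
    Summable.of_norm_bounded summable_one_div_sq abs_oddMoebiusTerm_le
  have hle : 2 - Real.pi ^ 2 / 6 ≤ ∑' a, oddMoebiusTerm a := by
    refine hasSum_le (fun a => ?_) hlow hsum.hasSum
    rcases eq_or_ne a 1 with rfl | ha
    · norm_num [oddMoebiusTerm]
    · have := (abs_le.mp (abs_oddMoebiusTerm_le a)).1
      simpa [ha] using this
  have hpi : Real.pi ^ 2 < 10 := by
    have := Real.pi_lt_d2
    nlinarith [Real.pi_pos]
  linarith

theorem tendsto_classCount_div {c : ℕ} (hc : c < 8) (hodd : Odd c) (a : ℕ) :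
    Tendsto (fun N : ℕ => (moebius a : ℝ) * classCount c a N / N) atTop
      (𝓝 (oddMoebiusTerm a / 8)) := by
  rcases Nat.even_or_odd a with ha | ha
  · simp [classCount_even hodd ha, oddMoebiusTerm, Nat.not_odd_iff_even.mpr ha]
  · have hlim : Tendsto (fun N : ℕ => (classCount c a N : ℝ) / N) atTop
        (𝓝 (1 / (8 * a ^ 2 : ℕ))) := by
      rw [tendsto_iff_norm_sub_tendsto_zero]
      refine squeeze_zero' (Eventually.of_forall fun _ => norm_nonneg _) ?_
        tendsto_one_div_atTop_nhds_zero_nat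
      filter_upwards [eventually_gt_atTop 0] with N hN
      have hN' : (0 : ℝ) < N := by exact_mod_cast hN
      have h1 : (classCount c a N : ℝ) / N - 1 / (8 * a ^ 2 : ℕ) =
          (classCount c a N - N / (8 * a ^ 2 : ℕ)) / N := by
        field_simp
      rw [h1, Real.norm_eq_abs, abs_div, abs_of_pos hN']
      gcongr
      exact abs_classCount_sub_le hc ha N
    have h2 := hlim.const_mul (moebius a : ℝ)
    have h3 : (moebius a : ℝ) * (1 / (8 * a ^ 2 : ℕ)) = oddMoebiusTerm a / 8 := by
      rw [oddMoebiusTerm, if_pos ha]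
      push_cast
      ring
    rw [h3] at h2
    exact h2.congr fun N => by ring

/-- Limit and Möbius sum are interchanged by dominated convergence with majorant `1/a²`. The limit
does not depend on the odd class. -/
theorem tendsto_squarefreeClassCount_div {c : ℕ} (hc : c < 8) (hodd : Odd c) :
    Tendsto (fun N : ℕ => (squarefreeClassCount c N : ℝ) / N) atTop
      (𝓝 ((∑' a, oddMoebiusTerm a) / 8)) := by
  have h := tendsto_tsum_of_dominated_convergence (𝓕 := atTop)
    (f := fun (N : ℕ) (a : ℕ) => (moebius a : ℝ) * classCount c a N / N)
    summable_one_div_sq (tendsto_classCount_div hc hodd) (by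
      filter_upwards [eventually_gt_atTop 0] with N hN a
      have hN' : (0 : ℝ) < N := by exact_mod_cast hN
      rw [Real.norm_eq_abs, abs_div, abs_mul, abs_of_pos hN', Nat.abs_cast, div_le_iff₀ hN']
      calc |(moebius a : ℝ)| * classCount c a N ≤ 1 * (N / (a : ℝ) ^ 2) :=
            mul_le_mul (abs_moebius_real_le_one a) (classCount_le c a N) (by positivity) zero_le_one
        _ = 1 / (a : ℝ) ^ 2 * N := by ring)
  rw [tsum_div_const] at h
  refine h.congr fun N => ?_
  have hs : (squarefreeClassCount c N : ℝ) =
      ∑ a ∈ Finset.Icc 1 N, (moebius a : ℝ) * classCount c a N := by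
    exact_mod_cast squarefreeClassCount_eq_sum c N
  rw [tsum_div_const, hs, tsum_eq_sum fun a ha => ?_]
  rw [Finset.mem_Icc, not_and_or] at ha
  rcases Nat.eq_zero_or_pos a with rfl | h0
  · simp
  · have : classCount c a N = 0 := by
      rw [classCount, Finset.card_eq_zero, Finset.filter_eq_empty_iff]
      rintro n hn ⟨-, h2⟩
      rw [Finset.mem_Icc] at hn
      have := Nat.le_of_dvd (by omega) h2
      nlinarith [ha.resolve_left (by omega)]
    simp [this]

end SquarefreeCount

/-! ### Densities of all squarefree numbers and of the class 3 modulo 8 -/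

/-- The number of odd squarefree `1 ≤ n ≤ N`. -/
def oddSquarefreeCount (N : ℕ) : ℕ := {n ∈ Finset.Icc 1 N | Odd n ∧ Squarefree n}.card

/-- The number of squarefree `1 ≤ n ≤ N`. -/
def squarefreeCount (N : ℕ) : ℕ := {n ∈ Finset.Icc 1 N | Squarefree n}.card

theorem oddSquarefreeCount_eq (N : ℕ) : oddSquarefreeCount N = squarefreeClassCount 1 N +
    squarefreeClassCount 3 N + squarefreeClassCount 5 N + squarefreeClassCount 7 N := by
  simp only [oddSquarefreeCount, squarefreeClassCount, Finset.card_filter, ← Finset.sum_add_distrib]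
  refine Finset.sum_congr rfl fun n _ => ?_
  by_cases hs : Squarefree n
  · simp only [hs, and_true, Nat.odd_iff]
    split_ifs <;> omega
  · simp [hs]

/-- An even squarefree number is twice an odd squarefree one, so the even ones have half the density
of the odd ones. -/
theorem squarefreeCount_eq (N : ℕ) :
    squarefreeCount N = oddSquarefreeCount N + oddSquarefreeCount (N / 2) := by
  have hsplit : squarefreeCount N = oddSquarefreeCount N +
      {n ∈ Finset.Icc 1 N | Even n ∧ Squarefree n}.card := by
    simp only [squarefreeCount, oddSquarefreeCount, Finset.card_filter, ← Finset.sum_add_distrib]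
    refine Finset.sum_congr rfl fun n _ => ?_
    rcases Nat.even_or_odd n with h | h
    · simp [h, Nat.not_odd_iff_even.mpr h]
    · simp [h, Nat.not_even_iff_odd.mpr h]
  rw [hsplit]
  congr 1
  have himage : {n ∈ Finset.Icc 1 N | Even n ∧ Squarefree n} =
      {n ∈ Finset.Icc 1 (N / 2) | Odd n ∧ Squarefree n}.image (2 * ·) := by
    ext n
    simp only [Finset.mem_filter, Finset.mem_Icc, Finset.mem_image]
    constructor
    · rintro ⟨⟨h1, h2⟩, heven, hsf⟩
      obtain ⟨k, rfl⟩ := heven.two_dvd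
      refine ⟨k, ⟨⟨by omega, by omega⟩, ?_, hsf.of_mul_right⟩, rfl⟩
      by_contra hk
      obtain ⟨j, rfl⟩ := (Nat.not_odd_iff_even.mp hk).two_dvd
      have := Nat.isUnit_iff.mp (hsf 2 ⟨j, by ring⟩)
      omega
    · rintro ⟨k, ⟨⟨h1, h2⟩, hodd, hsf⟩, rfl⟩
      refine ⟨⟨by omega, by omega⟩, even_two_mul k, ?_⟩
      exact (Nat.squarefree_mul (Nat.coprime_two_left.mpr hodd)).mpr ⟨Nat.prime_two.squarefree, hsf⟩
  rw [himage, Finset.card_image_of_injective _ fun a b h => by simpa using h, oddSquarefreeCount]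

theorem tendsto_oddSquarefreeCount_div :
    Tendsto (fun N : ℕ => (oddSquarefreeCount N : ℝ) / N) atTop
      (𝓝 ((∑' a, oddMoebiusTerm a) / 2)) := by
  have h (c : ℕ) (hc : c < 8) (ho : Odd c) := tendsto_squarefreeClassCount_div hc ho
  have hsum := (((h 1 (by norm_num) (by decide)).add (h 3 (by norm_num) (by decide))).add
    (h 5 (by norm_num) (by decide))).add (h 7 (by norm_num) (by decide))
  convert hsum using 2 with N
  · rw [oddSquarefreeCount_eq]
    push_cast
    ring
  · ring

theorem tendsto_squarefreeCount_div :
    Tendsto (fun N : ℕ => (squarefreeCount N : ℝ) / N) atTop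
      (𝓝 (3 / 4 * ∑' a, oddMoebiusTerm a)) := by
  have hhalf : Tendsto (fun N : ℕ => ((N / 2 : ℕ) : ℝ) / N) atTop (𝓝 (1 / 2)) := by
    have h1 := (tendsto_nat_floor_mul_div_atTop (R := ℝ) (a := 1 / 2) (by norm_num)).comp
      tendsto_natCast_atTop_atTop
    refine h1.congr fun N => ?_
    simp only [Function.comp]
    congr 2
    rw [← Nat.floor_div_eq_div (K := ℝ) N 2]
    congr 1
    push_cast
    ring
  have hcomp := tendsto_oddSquarefreeCount_div.comp
    (Nat.tendsto_div_const_atTop (two_ne_zero))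
  have h := tendsto_oddSquarefreeCount_div.add (hcomp.mul hhalf)
  have hval : (∑' a, oddMoebiusTerm a) / 2 + (∑' a, oddMoebiusTerm a) / 2 * (1 / 2) =
      3 / 4 * ∑' a, oddMoebiusTerm a := by ring
  rw [hval] at h
  refine h.congr' ?_
  filter_upwards [eventually_ge_atTop 2] with N hN
  have h1 : (N : ℝ) ≠ 0 := by exact_mod_cast (by omega : N ≠ 0)
  have h2 : ((N / 2 : ℕ) : ℝ) ≠ 0 := by exact_mod_cast (by omega : N / 2 ≠ 0)
  rw [squarefreeCount_eq]
  simp only [Function.comp]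
  rw [div_mul_div_cancel₀ h2]
  push_cast
  ring

theorem Filter.Tendsto.comp_floor_div {f : ℕ → ℝ} {l : ℝ}
    (h : Tendsto (fun N : ℕ => f N / N) atTop (𝓝 l)) :
    Tendsto (fun X : ℝ => f ⌊X⌋₊ / X) atTop (𝓝 l) := by
  have h1 := (h.comp (tendsto_nat_floor_atTop (α := ℝ))).mul (tendsto_nat_floor_div_atTop (R := ℝ))
  rw [mul_one] at h1
  refine h1.congr' ?_
  filter_upwards [eventually_ge_atTop 1] with X hX
  have : (⌊X⌋₊ : ℝ) ≠ 0 := by exact_mod_cast (Nat.floor_pos.mpr hX).ne'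
  simp only [Function.comp]
  rw [div_mul_div_cancel₀ this]

theorem finite_setOf_mem_le (U : Set ℕ) (X : ℝ) : {d ∈ U | (d : ℝ) ≤ X}.Finite :=
  (Set.finite_Iic ⌊X⌋₊).subset fun _ hd => Nat.le_floor hd.2

theorem tendsto_ncard_squarefreeNat :
    Tendsto (fun X : ℝ => ({d ∈ squarefreeNat | (d : ℝ) ≤ X}.ncard : ℝ) / X) atTop
      (𝓝 (3 / 4 * ∑' a, oddMoebiusTerm a)) := by
  -- The subtracted `1/X` removes `n = 1`, which is squarefree but not in `squarefreeNat`.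
  have h := tendsto_squarefreeCount_div.comp_floor_div.sub tendsto_inv_atTop_zero
  rw [sub_zero] at h
  refine h.congr' ?_
  filter_upwards [eventually_ge_atTop 1] with X hX
  have hset : ({n ∈ Finset.Icc 1 ⌊X⌋₊ | Squarefree n} : Set ℕ) =
      insert 1 {d ∈ squarefreeNat | (d : ℝ) ≤ X} := by
    ext n
    simp only [Set.mem_ofPred_eq, Set.mem_insert_iff, squarefreeNat, Finset.mem_Icc]
    constructor
    · rintro ⟨⟨h1, h2⟩, hs⟩
      rcases Nat.eq_or_lt_of_le h1 with h | h
      · exact Or.inl h.symm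
      · exact Or.inr ⟨⟨h, hs⟩, (Nat.le_floor_iff (by linarith)).mp h2⟩
    · rintro (rfl | ⟨⟨h1, hs⟩, h2⟩)
      · exact ⟨⟨le_rfl, Nat.le_floor (by simpa using hX)⟩, squarefree_one⟩
      · exact ⟨⟨by omega, Nat.le_floor h2⟩, hs⟩
  have hcard : squarefreeCount ⌊X⌋₊ = {d ∈ squarefreeNat | (d : ℝ) ≤ X}.ncard + 1 := by
    rw [← Set.ncard_insert_of_notMem (a := 1) (by simp [squarefreeNat]) (finite_setOf_mem_le _ X), ← hset,
      squarefreeCount, ← Set.ncard_coe_finset]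
    congr 1
    ext n
    simp
  rw [hcard]
  push_cast
  field_simp
  ring

theorem tendsto_ncard_squarefreeNat_three :
    Tendsto (fun X : ℝ => ({d ∈ {d ∈ squarefreeNat | d % 8 = 3} | (d : ℝ) ≤ X}.ncard : ℝ) / X)
      atTop (𝓝 ((∑' a, oddMoebiusTerm a) / 8)) := by
  refine (tendsto_squarefreeClassCount_div (c := 3) (by norm_num)
    (by decide)).comp_floor_div.congr' ?_
  filter_upwards [eventually_ge_atTop 1] with X hX
  congr 2
  rw [squarefreeClassCount, ← Set.ncard_coe_finset]
  congr 1
  ext n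
  simp only [Finset.coe_filter, Finset.mem_Icc, Set.mem_ofPred_eq, squarefreeNat]
  constructor
  · rintro ⟨⟨h1, h2⟩, h3, hs⟩
    exact ⟨⟨⟨by omega, hs⟩, h3⟩, (Nat.le_floor_iff (by linarith)).mp h2⟩
  · rintro ⟨⟨⟨h1, hs⟩, h3⟩, h2⟩
    exact ⟨⟨by omega, Nat.le_floor h2⟩, h3, hs⟩

/-! ### Relative densities and conclusion -/

/-- If `U` and `V` cover the squarefree integers up to squarefree parts of numbers `2 ^ m - 1`,
then the natural density of `V` determines the relative density of `U`. -/
theorem hasRelativeDensity_of_partition {U V : Set ℕ} {δ : ℝ} (hUV : Disjoint U V)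
    (hU : U ⊆ squarefreeNat) (hV : V ⊆ squarefreeNat)
    (hcover : ∀ d ∈ squarefreeNat, d ∈ U ∨ d ∈ V ∨ d ∈ mersenneSquarefreeParts)
    (hlim : Tendsto (fun X : ℝ => ({d ∈ V | (d : ℝ) ≤ X}.ncard : ℝ) / X) atTop
      (𝓝 (δ * (3 / 4 * ∑' a, oddMoebiusTerm a)))) :
    HasRelativeDensity U (1 - δ) := by
  have hA : (3 / 4 * ∑' a, oddMoebiusTerm a) ≠ 0 :=
    (mul_pos (by norm_num) tsum_oddMoebiusTerm_pos).ne'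
  set A := 3 / 4 * ∑' a, oddMoebiusTerm a
  have hq := tendsto_ncard_squarefreeNat
  set q : ℝ → ℝ := fun X => ({d ∈ squarefreeNat | (d : ℝ) ≤ X}.ncard : ℝ) with hqdef
  set u : ℝ → ℝ := fun X => ({d ∈ U | (d : ℝ) ≤ X}.ncard : ℝ) with hudef
  set v : ℝ → ℝ := fun X => ({d ∈ V | (d : ℝ) ≤ X}.ncard : ℝ) with hvdef
  set b : ℝ → ℝ := fun X => ({d ∈ mersenneSquarefreeParts | (d : ℝ) ≤ X}.ncard : ℝ) with hbdef
  have hb : Tendsto (fun X => b X / X) atTop (𝓝 0) := tendsto_ncard_mersenneSquarefreeParts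
  have hunion (X : ℝ) : u X + v X = ({d ∈ U ∪ V | (d : ℝ) ≤ X}.ncard : ℝ) := by
    have hset : {d ∈ U ∪ V | (d : ℝ) ≤ X} = {d ∈ U | (d : ℝ) ≤ X} ∪ {d ∈ V | (d : ℝ) ≤ X} := by
      ext d
      simp only [Set.mem_union, Set.mem_ofPred_eq]
      tauto
    rw [hset, Set.ncard_union_eq (hUV.mono (fun _ h => h.1) (fun _ h => h.1))
      (finite_setOf_mem_le _ X) (finite_setOf_mem_le _ X)]
    push_cast
    rfl
  have hupper (X : ℝ) : u X + v X ≤ q X := by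
    rw [hunion]
    have h1 : {d ∈ U ∪ V | (d : ℝ) ≤ X} ⊆ {d ∈ squarefreeNat | (d : ℝ) ≤ X} :=
      fun d hd => ⟨Set.union_subset hU hV hd.1, hd.2⟩
    exact Nat.cast_le.mpr (Set.ncard_le_ncard h1 (finite_setOf_mem_le _ X))
  have hlower (X : ℝ) : q X ≤ u X + v X + b X := by
    rw [hunion]
    have h1 : {d ∈ squarefreeNat | (d : ℝ) ≤ X} ⊆
        {d ∈ U ∪ V | (d : ℝ) ≤ X} ∪ {d ∈ mersenneSquarefreeParts | (d : ℝ) ≤ X} := by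
      rintro d ⟨hd, hdX⟩
      rcases hcover d hd with h | h | h
      · exact Or.inl ⟨Or.inl h, hdX⟩
      · exact Or.inl ⟨Or.inr h, hdX⟩
      · exact Or.inr ⟨h, hdX⟩
    have h2 := (Set.ncard_le_ncard h1 ((finite_setOf_mem_le _ X).union
      (finite_setOf_mem_le _ X))).trans (Set.ncard_union_le _ _)
    simp only [hqdef, hbdef]
    exact_mod_cast h2
  -- Squeeze: `q - v - b ≤ u ≤ q - v`, where `b` has density zero.
  have hu : Tendsto (fun X => u X / X) atTop (𝓝 (A - δ * A)) := by
    have hlo := (hq.sub hlim).sub hb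
    rw [sub_zero] at hlo
    refine tendsto_of_tendsto_of_tendsto_of_le_of_le' hlo (hq.sub hlim) ?_ ?_
    · filter_upwards [eventually_gt_atTop 0] with X hX
      rw [← sub_div, ← sub_div]
      gcongr
      linarith [hlower X]
    · filter_upwards [eventually_gt_atTop 0] with X hX
      rw [← sub_div]
      gcongr
      linarith [hupper X]
  have hdiv := hu.div hq hA
  rw [show (A - δ * A) / A = 1 - δ by field_simp] at hdiv
  refine hdiv.congr' ?_
  filter_upwards [eventually_gt_atTop 0] with X hX
  exact div_div_div_cancel_right₀ hX.ne' _ _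

theorem mem_mersenneSquarefreeParts_of_notMem {d : ℕ} (hd : d ∈ squarefreeNat)
    (h : d ∉ noRelevantSet) : d ∈ mersenneSquarefreeParts := by
  refine ⟨hd, exists_two_pow_eq_of_hasRelevantSolution hd.2 hd.1 ?_⟩
  by_contra hrel
  exact h ⟨hd, hrel⟩

theorem neg_modEq_five_iff (d : ℕ) : -(d : ℤ) ≡ 5 [ZMOD 8] ↔ d % 8 = 3 := by
  rw [Int.ModEq]
  omega

theorem mainTheorem6 :
    HasRelativeDensity noRelevantSet 1 ∧ HasRelativeDensity noRelevantSetNotFive (5 / 6) := by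
  constructor
  · have h := hasRelativeDensity_of_partition (U := noRelevantSet) (V := ∅) (δ := 0) (by simp)
      (fun d hd => hd.1) (by simp)
      (fun d hd => by
        by_cases hC : d ∈ noRelevantSet
        · exact Or.inl hC
        · exact Or.inr (Or.inr (mem_mersenneSquarefreeParts_of_notMem hd hC)))
      (by simp)
    simpa using h
  -- Here `-d ≡ 5` means `d ≡ 3 (mod 8)`, a class of relative density `(1/8) / (3/4) = 1/6`.
  · have h := hasRelativeDensity_of_partition (U := noRelevantSetNotFive)
      (V := {d ∈ squarefreeNat | d % 8 = 3}) (δ := 1 / 6)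
      (Set.disjoint_left.mpr fun d hd hd' => hd.2 ((neg_modEq_five_iff d).mpr hd'.2))
      (fun d hd => hd.1.1) (fun d hd => hd.1)
      (fun d hd => by
        by_cases hC : d ∈ noRelevantSet
        · by_cases h3 : d % 8 = 3
          · exact Or.inr (Or.inl ⟨hd, h3⟩)
          · exact Or.inl ⟨hC, mt (neg_modEq_five_iff d).mp h3⟩
        · exact Or.inr (Or.inr (mem_mersenneSquarefreeParts_of_notMem hd hC)))
      (by
        convert tendsto_ncard_squarefreeNat_three using 2
        ring)
    norm_num at h
    exact h
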